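/- Let $s\ge 5$ be an odd integer and let $\mathbb G$ be the type II filiform group of step $s$, i.e. the connected, simply connected nilpotent Lie group whose Lie algebra $\mathfrak g$ has a basis $X_1,\dots,X_{s+1}$ with $$[X_1,X_k]=X_{k+1}\quad(2\le k\le s-1),\qquad X_{s+1}=(-1)^k[X_k,X_{s+2-k}]\quad(2\le k\le s),$$ all other brackets of basis elements being zero; its first layer is $\mathfrak g_1=\mathrm{span}\{X_1,X_2\}$. Identify $\mathbb G$ with $\mathfrak g\cong\mathbb R^{s+1}$ by the exponential map (so that the group law is the Baker–Campbell–Hausdorff product and the identity is $e=0$), and identify $\mathfrak g_1$ with $\mathbb R^2$ by $u\leftrightarrow u_1X_1+u_2X_2$. For every control $u\in L^1([0,1],\mathfrak g_1)$ there is exactly one absolutely continuous curve $\gamma_u:[0,1]\to\mathbb G$ with $\gamma_u(0)=e$ and $\dot\gamma_u(t)=(dL_{\gamma_u(t)})_e\,u(t)$ for a.e. $t\in[0,1]$, where $L_g$ denotes left translation by $g$. The endpoint map $F:L^1([0,1],\mathfrak g_1)\to\mathbb G$, $F(u)=\gamma_u(1)$, is Fréchet differentiable. Call $u$ singular if the differential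 $d_uF$ is not surjective. Then $u\in L^1([0,1],\mathfrak g_1)$ is singular if and only if there exists $a\in\mathbb R$ such that for a.e. $t\in[0,1]$ both of the following hold: (i) $u_1(t)=0$ or $u_2(t)=0$; (ii) if $u_1(t)\ne 0$, then $\int_0^t u_2(\tau)\,d\tau=a$. -/

import Mathlib

open MeasureTheory

noncomputable section

namespace Carnot

/-! ### The simply connected nilpotent group of a nilpotent Lie algebra

Let `𝔤` be a nilpotent real Lie algebra of step `s`. The exponential map of the connected, simply
connected Lie group `G` with Lie algebra `𝔤` is a diffeomorphism; together with a basis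
`X` of `𝔤` it identifies `G` with `Fin n → ℝ`, the point `p` standing for `exp (∑ i, p i • X i)`.
In these coordinates the identity is `0` and the group law is the Baker-Campbell-Hausdorff product
`log (exp x exp y) = x + ∫ t in 0..1, g (e ^ (ad x) e ^ (t ad y)) y`, where
`g z = z log z / (z - 1) = 1 + ∑_{m ≥ 1} (-1) ^ (m + 1) / (m (m + 1)) (z - 1) ^ m`.
All power series are finite sums because `(ad x) ^ s = 0`. -/

variable {𝔤 : Type*} [LieRing 𝔤] [LieAlgebra ℝ 𝔤]

/-- `e ^ (ad x)`, in a Lie algebra of step at most `s`. -/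
def expAd (s : ℕ) (x : 𝔤) : Module.End ℝ 𝔤 :=
  ∑ k ∈ Finset.range (s + 1), ((k.factorial : ℝ)⁻¹) • (LieAlgebra.ad ℝ 𝔤 x) ^ k

/-- `g A = 1 + ∑_{m ≥ 1} (-1) ^ (m + 1) / (m (m + 1)) (A - 1) ^ m`, for `A` unipotent
with `(A - 1) ^ (s + 1) = 0`. -/
def bchSeries (s : ℕ) (A : Module.End ℝ 𝔤) : Module.End ℝ 𝔤 :=
  1 + ∑ m ∈ Finset.Icc 1 s, ((-1 : ℝ) ^ (m + 1) / ((m : ℝ) * ((m : ℝ) + 1))) • (A - 1) ^ m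

/-- The group law of the group `G` of `𝔤` in exponential coordinates. -/
def groupMul (s : ℕ) {n : ℕ} (X : Module.Basis (Fin n) ℝ 𝔤) (p q : Fin n → ℝ) : Fin n → ℝ :=
  p + ∫ t in (0 : ℝ)..1,
    X.equivFun (bchSeries s
      (expAd s (X.equivFun.symm p) * expAd s (t • X.equivFun.symm q)) (X.equivFun.symm q))

/-- The differential at the identity of the left translation by `p`. -/
def leftTranslationDeriv (s : ℕ) {n : ℕ} (X : Module.Basis (Fin n) ℝ 𝔤) (p : Fin n → ℝ) :
    (Fin n → ℝ) →L[ℝ] (Fin n → ℝ) :=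
  fderiv ℝ (fun q : Fin n → ℝ => groupMul s X p q) 0

/-- Controls of rank 2: `L¹([0,1], ℝ²)`, where `ℝ²` is identified with the first layer
`𝔤₁ = span {X₁, X₂}` through the basis `X₁, X₂`. -/
abbrev Control : Type :=
  Lp (EuclideanSpace ℝ (Fin 2)) 1 (volume.restrict (Set.Icc (0 : ℝ) 1))

/-- Coordinates of the vector `v₁ X₁ + v₂ X₂` of the first layer; `X₁` and `X₂` are the basis vectors
with indices `0` and `1` in `Fin n`. -/
def horizontalVector (n : ℕ) (v : EuclideanSpace ℝ (Fin 2)) : Fin n → ℝ :=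
  fun i => if (i : ℕ) = 0 then v 0 else if (i : ℕ) = 1 then v 1 else 0

/-- `γ`, restricted to `[0,1]`, is the absolutely continuous curve issuing from the identity whose
derivative is `(dL_{γ(t)})_e u(t)` for almost every `t`. -/
def IsHorizontalCurve (s : ℕ) {n : ℕ} (X : Module.Basis (Fin n) ℝ 𝔤) (u : Control)
    (γ : ℝ → Fin n → ℝ) : Prop :=
  AbsolutelyContinuousOnInterval γ 0 1 ∧ γ 0 = 0 ∧
    ∀ᵐ t ∂(volume.restrict (Set.Icc (0 : ℝ) 1)),
      HasDerivAt γ (leftTranslationDeriv s X (γ t) (horizontalVector n (u t))) t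

open Classical in
/-- The endpoint map `F u = γ_u(1)`. -/
def endpointMap (s : ℕ) {n : ℕ} (X : Module.Basis (Fin n) ℝ 𝔤) (u : Control) : Fin n → ℝ :=
  if h : ∃ γ, IsHorizontalCurve s X u γ then h.choose 1 else 0

/-- `u` is singular if the differential `d_u F` of the endpoint map is not surjective. -/
def IsSingularControl (s : ℕ) {n : ℕ} (X : Module.Basis (Fin n) ℝ 𝔤) (u : Control) : Prop :=
  ¬ Function.Surjective (fderiv ℝ (endpointMap s X) u)

/-- The bracket relations of the type II filiform algebra of (odd) step `s` in a basis
`X₁, …, X_{s+1}`. Since `Fin (s + 1)` starts at `0`, the vector `X_k` is written `X (k - 1)`.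
* `[X₁, X_k] = X_{k+1}` for `2 ≤ k ≤ s - 1`;
* `X_{s+1} = (-1)^k [X_k, X_{s+2-k}]` for `2 ≤ k ≤ s`;
* every other bracket of two basis vectors is zero. -/
structure IsTypeIIFiliform (s : ℕ) (X : Module.Basis (Fin (s + 1)) ℝ 𝔤) : Prop where
  odd_step : Odd s
  bracket_first : ∀ i j : Fin (s + 1), 1 ≤ (i : ℕ) → (i : ℕ) + 2 ≤ s → (j : ℕ) = i + 1 →
    ⁅X 0, X i⁆ = X j
  bracket_first_zero : ∀ i : Fin (s + 1), s ≤ (i : ℕ) + 1 → ⁅X 0, X i⁆ = 0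
  bracket_last : ∀ i j : Fin (s + 1), 1 ≤ (i : ℕ) → 1 ≤ (j : ℕ) → (i : ℕ) + j = s →
    X (Fin.last s) = (-1 : ℝ) ^ ((i : ℕ) + 1) • ⁅X i, X j⁆
  bracket_zero : ∀ i j : Fin (s + 1), 1 ≤ (i : ℕ) → 1 ≤ (j : ℕ) → (i : ℕ) + j ≠ s →
    ⁅X i, X j⁆ = 0

end Carnot

end

/-! The group acts simply transitively by affine maps on an affine space of dimension s + 1.
Concretely, `rep` represents 𝔤 on states in ℝ^(s+2) whose entry 0 is never moved, and the orbit of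
the base state e₀ under `frame s X p` = exp(-rep p) is a triangular C¹ change of coordinates with C¹
inverse (`exists_contDiff_inverse_modelCoord`). The exponential coordinates, with their
Baker-Campbell-Hausdorff law, can thus be traded for a linear picture.

The bridge is `fderiv_frame_leftTranslationDeriv`. The differential of left translation is the
series ad x / (1 - e^(-ad x)), while differentiating the exponential produces (1 - e^(-ad x)) / ad
x; the two cancel. Hence a horizontal curve satisfies a linear equation q' = B(u) q with B(u)
strictly triangular. The corresponding Volterra operator V is nilpotent, so the solution (1 - V)⁻¹
q₀ exists, is unique, and is differentiable in u. Existence and uniqueness of γ_u and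
differentiability of F follow by transport.

Variation of constants (`apply_fderiv_linSol`) identifies the differential: its range is proper
exactly when some covector μ that is nonzero on rep(𝔤) e₀ satisfies ⟨μ, Ad(γ(t)) X₁⟩ = ⟨μ, Ad(γ(t))
X₂⟩ = 0 for all t (`not_surjective_iff`, where Ad(γ) x acts on e₀).

With a i = ⟨μ, Ad(γ) X_{i+1}⟩ the bracket relations give a₀' = -u₂ a₂, aᵢ' = u₁ aᵢ₊₁ for 1 ≤ i ≤ s -
2, a_{s-1}' = u₂ a_s, and a_s is constant. A function has zero derivative at almost every one of its
zeros, so a₁ = 0 forces a₂, …, a_{s-1} to vanish almost everywhere on {u₁ ≠ 0}. If a_s ≠ 0, then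
a_{s-1} = a_{s-1}(0) + a_s ∫ u₂ vanishes there, which fixes the level of ∫ u₂ and makes u₂ = 0
there. If a_s = 0, then u₁ ≠ 0 on a set of positive measure would make the whole covector vanish
(`exists_level`). Conversely, the level determines an initial covector whose components up to
a_{s-2} stay zero (`eq_zero_of_level`). -/

namespace Carnot

/-! ### The linear model and its commutation relations -/

/-- The operators of the linear model: the state `f` carries the constant `f 0`, the two
horizontal coordinates `f 1`, `f 2`, the iterated integrals `f 3, …, f s` and the central
coordinate `f (s + 1)`. -/
noncomputable def modelFun (s : ℕ) (i : Fin (s + 1)) (f : Fin (s + 2) → ℝ) (k : Fin (s + 2)) : ℝ :=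
  if (i : ℕ) = 0 then
    if (k : ℕ) = 1 then - f 0
    else if 3 ≤ (k : ℕ) ∧ (k : ℕ) ≤ s then - f ⟨k - 1, by omega⟩ else 0
  else if (i : ℕ) = s then
    if (k : ℕ) = s + 1 then -2 * f 0 else 0
  else
    (if (k : ℕ) = i + 1 then (-1 : ℝ) ^ (i : ℕ) * f 0 else 0)
      - if (k : ℕ) = s + 1 then f ⟨s + 1 - i, by omega⟩ else 0

noncomputable def modelOp (s : ℕ) (i : Fin (s + 1)) : (Fin (s + 2) → ℝ) →ₗ[ℝ] (Fin (s + 2) → ℝ) where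
  toFun := modelFun s i
  map_add' f g := by
    ext k
    simp only [modelFun, Pi.add_apply]
    split_ifs <;> ring
  map_smul' c f := by
    ext k
    simp only [modelFun, Pi.smul_apply, smul_eq_mul, RingHom.id_apply]
    split_ifs <;> ring

theorem modelOp_apply (s : ℕ) (i : Fin (s + 1)) (f : Fin (s + 2) → ℝ) (k : Fin (s + 2)) :
    modelOp s i f k = modelFun s i f k := rfl

theorem modelOp_first_apply {s : ℕ} (f : Fin (s + 2) → ℝ) (k : Fin (s + 2)) :
    modelOp s 0 f k = if (k : ℕ) = 1 then - f 0
      else if 3 ≤ (k : ℕ) ∧ (k : ℕ) ≤ s then - f ⟨k - 1, by omega⟩ else 0 := by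
  simp [modelOp_apply, modelFun]

theorem modelOp_last_apply {s : ℕ} (hs : 5 ≤ s) (i : Fin (s + 1)) (hi : (i : ℕ) = s)
    (f : Fin (s + 2) → ℝ) (k : Fin (s + 2)) :
    modelOp s i f k = if (k : ℕ) = s + 1 then -2 * f 0 else 0 := by
  rw [modelOp_apply, modelFun, if_neg (by omega), if_pos hi]

theorem modelOp_mid_apply {s : ℕ} (i : Fin (s + 1)) (h1 : 1 ≤ (i : ℕ)) (h2 : (i : ℕ) < s)
    (f : Fin (s + 2) → ℝ) (k : Fin (s + 2)) :
    modelOp s i f k = (if (k : ℕ) = i + 1 then (-1 : ℝ) ^ (i : ℕ) * f 0 else 0)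
      - if (k : ℕ) = s + 1 then f ⟨s + 1 - i, by omega⟩ else 0 := by
  rw [modelOp_apply, modelFun, if_neg (by omega), if_neg (by omega)]

theorem modelOp_apply_zero {s : ℕ} (i : Fin (s + 1)) (f : Fin (s + 2) → ℝ) :
    modelOp s i f 0 = 0 := by
  simp [modelOp_apply, modelFun]

theorem modelOp_apply_succ_of_lt {s : ℕ} (i j : Fin (s + 1)) (h : i < j)
    (f : Fin (s + 2) → ℝ) : modelOp s j f i.succ = 0 := by
  have hj : (i : ℕ) < j := h
  have hj' := j.2
  rw [modelOp_apply, modelFun, if_neg (by omega)]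
  simp only [Fin.val_succ]
  split_ifs <;> first | omega | simp

/-- The diagonal coefficients of the model. -/
noncomputable def modelDiag (s : ℕ) (i : Fin (s + 1)) : ℝ :=
  if (i : ℕ) = 0 then -1 else if (i : ℕ) = s then -2 else (-1) ^ (i : ℕ)

theorem modelDiag_ne_zero (s : ℕ) (i : Fin (s + 1)) : modelDiag s i ≠ 0 := by
  unfold modelDiag
  split_ifs <;> simp

theorem modelOp_apply_succ_self {s : ℕ} (i : Fin (s + 1)) (f : Fin (s + 2) → ℝ) :
    modelOp s i f i.succ = modelDiag s i * f 0 := by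
  have hi := i.2
  simp only [modelOp_apply, modelFun, modelDiag, Fin.val_succ]
  split_ifs <;> first | omega | simp

/-- Strict triangularity of the model. It is behind both the triangular shape of the orbit
coordinates and the nilpotency of the Volterra operator. -/
theorem modelOp_apply_succ_congr {s : ℕ} (i j : Fin (s + 1)) (f g : Fin (s + 2) → ℝ)
    (h : ∀ m : Fin (s + 2), (m : ℕ) ≤ i → f m = g m) :
    modelOp s j f i.succ = modelOp s j g i.succ := by
  have h0 : f 0 = g 0 := h 0 (Nat.zero_le _)
  have hi := i.2
  have hj := j.2
  simp only [modelOp_apply, modelFun, Fin.val_succ, h0]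
  split_ifs with h1 _ _ _ _ _ h5 <;> first
    | rfl
    | (rw [h ⟨_, _⟩ (by first | (simp; done) | (simp; omega))])

theorem modelOp_commutator_first {s : ℕ} (i j : Fin (s + 1)) (h1 : 1 ≤ (i : ℕ))
    (h2 : (i : ℕ) + 2 ≤ s) (hj : (j : ℕ) = i + 1) (f : Fin (s + 2) → ℝ) :
    modelOp s 0 (modelOp s i f) - modelOp s i (modelOp s 0 f) = modelOp s j f := by
  ext k
  have hk := k.2
  rw [Pi.sub_apply, modelOp_first_apply (modelOp s i f), modelOp_apply_zero,
    modelOp_mid_apply i h1 (by omega) (modelOp s 0 f), modelOp_apply_zero]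
  simp only [modelOp_first_apply, modelOp_mid_apply i h1 (by omega : (i : ℕ) < s),
    modelOp_mid_apply j (by omega : 1 ≤ (j : ℕ)) (by omega)]
  have e : (⟨s + 1 - i - 1, by omega⟩ : Fin (s + 2)) = ⟨s + 1 - j, by omega⟩ := by
    ext; simp; omega
  simp only [hj, pow_succ, e]
  split_ifs <;> first | omega | ring

theorem modelOp_commutator_first_zero {s : ℕ} (hs : 5 ≤ s) (i : Fin (s + 1)) (h1 : s ≤ (i : ℕ) + 1)
    (f : Fin (s + 2) → ℝ) :
    modelOp s 0 (modelOp s i f) - modelOp s i (modelOp s 0 f) = 0 := by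
  ext k
  have hk := k.2
  have hi := i.2
  rw [Pi.sub_apply, modelOp_first_apply, modelOp_apply_zero]
  rcases Nat.lt_or_ge (i : ℕ) s with h | h
  · rw [modelOp_mid_apply i (by omega) h, modelOp_mid_apply i (by omega) h, modelOp_apply_zero,
      modelOp_first_apply]
    simp only [Pi.zero_apply]
    split_ifs <;> first | omega | ring
  · rw [modelOp_last_apply hs i (by omega), modelOp_last_apply hs i (by omega), modelOp_apply_zero]
    simp only [Pi.zero_apply]
    split_ifs <;> first | omega | ring

theorem modelOp_commutator_last {s : ℕ} (hs : 5 ≤ s) (ho : Odd s) (i j : Fin (s + 1))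
    (h1 : 1 ≤ (i : ℕ)) (h2 : 1 ≤ (j : ℕ)) (hij : (i : ℕ) + j = s) (f : Fin (s + 2) → ℝ) :
    modelOp s i (modelOp s j f) - modelOp s j (modelOp s i f)
      = (-1 : ℝ) ^ ((i : ℕ) + 1) • modelOp s (Fin.last s) f := by
  -- Oddness of `s` gives `i` and `j` opposite parity, so the two contributions to the central entry
  -- add up instead of cancelling. This doubling is the origin of the coefficient -2 in `modelFun`.
  have hpow : (-1 : ℝ) ^ (j : ℕ) = - (-1 : ℝ) ^ (i : ℕ) := by
    have : (-1 : ℝ) ^ (i : ℕ) * (-1 : ℝ) ^ (j : ℕ) = -1 := by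
      rw [← pow_add, hij, ho.neg_one_pow]
    rcases neg_one_pow_eq_or ℝ (i : ℕ) with h | h <;> rw [h] at this ⊢ <;> linarith
  ext k
  have hk := k.2
  rw [Pi.sub_apply, modelOp_mid_apply i h1 (by omega) (modelOp s j f), modelOp_apply_zero,
    modelOp_mid_apply j h2 (by omega) (modelOp s i f), modelOp_apply_zero]
  simp only [Pi.smul_apply, modelOp_mid_apply i h1 (by omega : (i : ℕ) < s),
    modelOp_mid_apply j h2 (by omega : (j : ℕ) < s), modelOp_last_apply hs _ (Fin.val_last s),
    hpow, pow_succ, smul_eq_mul]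
  split_ifs <;> first | omega | ring

theorem modelOp_commutator_zero {s : ℕ} (hs : 5 ≤ s) (i j : Fin (s + 1))
    (h1 : 1 ≤ (i : ℕ)) (h2 : 1 ≤ (j : ℕ)) (hij : (i : ℕ) + j ≠ s) (f : Fin (s + 2) → ℝ) :
    modelOp s i (modelOp s j f) - modelOp s j (modelOp s i f) = 0 := by
  have key : ∀ i j : Fin (s + 1), 1 ≤ (i : ℕ) → 1 ≤ (j : ℕ) → (i : ℕ) + j ≠ s →
      modelOp s i (modelOp s j f) = 0 := by
    intro i j h1 h2 hij
    ext k
    have hk := k.2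
    have hi := i.2
    have hj := j.2
    rcases Nat.lt_or_ge (i : ℕ) s with h | h
    · rw [modelOp_mid_apply i h1 h, modelOp_apply_zero]
      rcases Nat.lt_or_ge (j : ℕ) s with h' | h'
      · rw [modelOp_mid_apply j h2 h']
        simp only [Pi.zero_apply]
        split_ifs <;> first | omega | ring
      · rw [modelOp_last_apply hs j (by omega)]
        simp only [Pi.zero_apply]
        split_ifs <;> first | omega | ring
    · rw [modelOp_last_apply hs i (by omega), modelOp_apply_zero]
      simp
  rw [key i j h1 h2 hij, key j i h2 h1 (by omega), sub_zero]

end Carnot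

/-! ### The representation of the Lie algebra and nilpotency of the adjoint action -/

namespace Carnot

variable {𝔤 : Type*} [LieRing 𝔤] [LieAlgebra ℝ 𝔤]

theorem IsTypeIIFiliform.bracket_eq_smul_last {s : ℕ} {X : Module.Basis (Fin (s + 1)) ℝ 𝔤}
    (hX : IsTypeIIFiliform s X) (i j : Fin (s + 1)) (h1 : 1 ≤ (i : ℕ)) (h2 : 1 ≤ (j : ℕ))
    (hij : (i : ℕ) + j = s) : ⁅X i, X j⁆ = (-1 : ℝ) ^ ((i : ℕ) + 1) • X (Fin.last s) := by
  rw [hX.bracket_last i j h1 h2 hij, smul_smul, ← mul_pow]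
  simp

/-- The linear model as a representation by endomorphisms. -/
noncomputable def rep (s : ℕ) (X : Module.Basis (Fin (s + 1)) ℝ 𝔤) :
    𝔤 →ₗ[ℝ] Module.End ℝ (Fin (s + 2) → ℝ) :=
  X.constr ℝ (modelOp s)

theorem rep_basis (s : ℕ) (X : Module.Basis (Fin (s + 1)) ℝ 𝔤) (i : Fin (s + 1)) :
    rep s X (X i) = modelOp s i := by
  simp [rep]

theorem IsTypeIIFiliform.rep_lie_basis {s : ℕ} (hs : 5 ≤ s) {X : Module.Basis (Fin (s + 1)) ℝ 𝔤}
    (hX : IsTypeIIFiliform s X) (i j : Fin (s + 1)) :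
    rep s X ⁅X i, X j⁆ = rep s X (X i) * rep s X (X j) - rep s X (X j) * rep s X (X i) := by
  have first : ∀ j : Fin (s + 1), 1 ≤ (j : ℕ) →
      rep s X ⁅X 0, X j⁆ = rep s X (X 0) * rep s X (X j) - rep s X (X j) * rep s X (X 0) := by
    intro j hj
    rcases Nat.lt_or_ge (j + 1 : ℕ) s with h | h
    · rw [hX.bracket_first j ⟨j + 1, by omega⟩ hj (by omega) rfl]
      refine LinearMap.ext fun f => ?_
      simp only [rep_basis]
      exact (modelOp_commutator_first j _ hj (by omega) rfl f).symm
    · rw [hX.bracket_first_zero j h, map_zero]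
      refine LinearMap.ext fun f => ?_
      simp only [rep_basis]
      exact (modelOp_commutator_first_zero hs j h f).symm
  rcases Nat.eq_zero_or_pos (i : ℕ) with hi | hi
  · obtain rfl : i = 0 := Fin.ext hi
    rcases Nat.eq_zero_or_pos (j : ℕ) with hj | hj
    · obtain rfl : j = 0 := Fin.ext hj
      simp
    · exact first j hj
  · rcases Nat.eq_zero_or_pos (j : ℕ) with hj | hj
    · obtain rfl : j = 0 := Fin.ext hj
      rw [← lie_skew, map_neg, first i hi, neg_sub]
    · by_cases hij : (i : ℕ) + j = s
      · rw [hX.bracket_eq_smul_last i j hi hj hij, map_smul]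
        refine LinearMap.ext fun f => ?_
        simp only [rep_basis]
        exact (modelOp_commutator_last hs hX.odd_step i j hi hj hij f).symm
      · rw [hX.bracket_zero i j hi hj hij, map_zero]
        refine LinearMap.ext fun f => ?_
        simp only [rep_basis]
        exact (modelOp_commutator_zero hs i j hi hj hij f).symm

theorem IsTypeIIFiliform.rep_lie {s : ℕ} (hs : 5 ≤ s) {X : Module.Basis (Fin (s + 1)) ℝ 𝔤}
    (hX : IsTypeIIFiliform s X) (x y : 𝔤) :
    rep s X ⁅x, y⁆ = rep s X x * rep s X y - rep s X y * rep s X x := by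
  induction X.mem_span x using Submodule.span_induction with
  | zero => simp
  | add a b _ _ ha hb => rw [add_lie, map_add, map_add, ha, hb]; noncomm_ring
  | smul c a _ ha => rw [smul_lie, map_smul, map_smul, ha]; simp [smul_sub]
  | mem a h =>
    obtain ⟨i, rfl⟩ := h
    induction X.mem_span y using Submodule.span_induction with
    | zero => simp
    | add a b _ _ ha hb => rw [lie_add, map_add, map_add, ha, hb]; noncomm_ring
    | smul c a _ ha => rw [lie_smul, map_smul, map_smul, ha]; simp [smul_sub]
    | mem a h =>
      obtain ⟨j, rfl⟩ := h
      exact hX.rep_lie_basis hs i j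

/-- Bracketing strictly raises the basis index, so the spans of the final segments of the basis form
a filtration that each ad x moves one step down. -/
theorem IsTypeIIFiliform.repr_lie_basis_eq_zero {s : ℕ} {X : Module.Basis (Fin (s + 1)) ℝ 𝔤}
    (hX : IsTypeIIFiliform s X) (i j k : Fin (s + 1)) (hk : k ≤ j) :
    X.repr ⁅X i, X j⁆ k = 0 := by
  have hk' : (k : ℕ) ≤ j := hk
  have first : ∀ j : Fin (s + 1), 1 ≤ (j : ℕ) → (k : ℕ) ≤ j → X.repr ⁅X 0, X j⁆ k = 0 := by
    intro j hj hk
    rcases Nat.lt_or_ge (j + 1 : ℕ) s with h | h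
    · rw [hX.bracket_first j ⟨j + 1, by omega⟩ hj (by omega) rfl, X.repr_self,
        Finsupp.single_eq_of_ne]
      intro h'
      rw [h'] at hk
      simp at hk
    · simp [hX.bracket_first_zero j h]
  rcases Nat.eq_zero_or_pos (i : ℕ) with hi | hi
  · obtain rfl : i = 0 := Fin.ext hi
    rcases Nat.eq_zero_or_pos (j : ℕ) with hj | hj
    · obtain rfl : j = 0 := Fin.ext hj
      simp
    · exact first j hj hk'
  · rcases Nat.eq_zero_or_pos (j : ℕ) with hj | hj
    · obtain rfl : j = 0 := Fin.ext hj
      rw [← lie_skew, map_neg, Finsupp.neg_apply, first i hi (by simp at hk'; omega), neg_zero]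
    · by_cases hij : (i : ℕ) + j = s
      · rw [hX.bracket_eq_smul_last i j hi hj hij, map_smul, Finsupp.smul_apply, X.repr_self,
          Finsupp.single_eq_of_ne, smul_zero]
        intro h'
        rw [h'] at hk'
        simp at hk'
        omega
      · simp [hX.bracket_zero i j hi hj hij]

theorem IsTypeIIFiliform.repr_lie_eq_zero {s : ℕ} {X : Module.Basis (Fin (s + 1)) ℝ 𝔤}
    (hX : IsTypeIIFiliform s X) (x y : 𝔤) (n : ℕ)
    (hy : ∀ j : Fin (s + 1), (j : ℕ) < n → X.repr y j = 0) (k : Fin (s + 1)) (hk : (k : ℕ) < n + 1) :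
    X.repr ⁅x, y⁆ k = 0 := by
  rw [← X.sum_repr x, ← X.sum_repr y, sum_lie]
  simp only [lie_sum, map_sum, Finsupp.coe_finsetSum, Finset.sum_apply]
  refine Finset.sum_eq_zero fun i _ => Finset.sum_eq_zero fun j _ => ?_
  rw [smul_lie, lie_smul, map_smul, map_smul, Finsupp.smul_apply, Finsupp.smul_apply]
  rcases Nat.lt_or_ge (j : ℕ) n with h | h
  · rw [hy j h]; simp
  · rw [hX.repr_lie_basis_eq_zero i j k (Fin.mk_le_mk.2 (by omega) : k ≤ j)]; simp

/-- Exponent `s + 1` comes from the length of the filtration. It is not sharp, but it suffices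
because the truncated series retain the powers up to `s`. -/
theorem IsTypeIIFiliform.ad_pow_eq_zero {s : ℕ} {X : Module.Basis (Fin (s + 1)) ℝ 𝔤}
    (hX : IsTypeIIFiliform s X) (x : 𝔤) : (LieAlgebra.ad ℝ 𝔤 x) ^ (s + 1) = 0 := by
  refine LinearMap.ext fun y => X.repr.injective (Finsupp.ext fun k => ?_)
  have key : ∀ n : ℕ, ∀ k : Fin (s + 1), (k : ℕ) < n →
      X.repr (((LieAlgebra.ad ℝ 𝔤 x) ^ n) y) k = 0 := by
    intro n
    induction n with
    | zero => intro k hk; omega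
    | succ n ih =>
      intro k hk
      rw [pow_succ', Module.End.mul_apply, LieAlgebra.ad_apply]
      exact hX.repr_lie_eq_zero x _ n ih k hk
  simpa using key (s + 1) k k.2

end Carnot

/-! ### The Baker-Campbell-Hausdorff series as a formal power series -/

namespace Carnot

section PowerSeriesIdentity

open Polynomial

/-- The truncated exponential series. -/
noncomputable def expPoly (s : ℕ) : ℝ[X] :=
  ∑ k ∈ Finset.range (s + 1), ((k.factorial : ℝ)⁻¹) • X ^ k

/-- The truncation of `X / (1 - e ^ (-X))`, as the series in `e ^ X - 1`. -/
noncomputable def bchPoly (s : ℕ) : ℝ[X] :=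
  1 + ∑ m ∈ Finset.Icc 1 s,
    ((-1 : ℝ) ^ (m + 1) / ((m : ℝ) * ((m : ℝ) + 1))) • (expPoly s - 1) ^ m

/-- The truncation of `(1 - e ^ (-X)) / X`. -/
noncomputable def leftDexpPoly (s : ℕ) : ℝ[X] :=
  ∑ k ∈ Finset.range (s + 1), ((-1 : ℝ) ^ k / ((k + 1).factorial : ℝ)) • X ^ k

/-- The splitting 1/(m(m+1)) = 1/m - 1/(m+1) turns the series g into (1 + y) log(1 + y) / y. Keeping
the exact remainder in degree s + 2 allows a plain induction. -/
theorem bch_mul_eq_log {A : Type*} [CommRing A] [Algebra ℝ A] (y : A) (s : ℕ) :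
    (1 + ∑ m ∈ Finset.Icc 1 s, ((-1 : ℝ) ^ (m + 1) / ((m : ℝ) * ((m : ℝ) + 1))) • y ^ m) * y
      = (1 + y) * ∑ m ∈ Finset.range (s + 1), ((-1 : ℝ) ^ m / ((m : ℝ) + 1)) • y ^ (m + 1)
        + ((-1 : ℝ) ^ (s + 1) / ((s : ℝ) + 1)) • y ^ (s + 2) := by
  induction s with
  | zero => simp; ring
  | succ s ih =>
    rw [Finset.sum_Icc_succ_top (by omega), ← add_assoc, add_mul _ _ y, ih, Finset.sum_range_succ _ (s + 1),
      mul_add (1 + y)]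
    have h1 : ((-1 : ℝ) ^ (s + 1 + 1) / (((s + 1 : ℕ) : ℝ) * (((s + 1 : ℕ) : ℝ) + 1)))
        = (-1 : ℝ) ^ (s + 1) / (((s + 1 : ℕ) : ℝ) + 1) - (-1 : ℝ) ^ (s + 1) / ((s : ℝ) + 1) := by
      push_cast
      have : (s : ℝ) + 1 ≠ 0 := by positivity
      have : (s : ℝ) + 1 + 1 ≠ 0 := by positivity
      field_simp
      ring
    have h2 : ((-1 : ℝ) ^ (s + 1 + 1) / (((s + 1 : ℕ) : ℝ) + 1))
        = - ((-1 : ℝ) ^ (s + 1) / (((s + 1 : ℕ) : ℝ) + 1)) := by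
      rw [pow_succ]; ring
    rw [h1, h2]
    simp only [Algebra.smul_def, map_sub, map_neg]
    ring

/-- `log (1 + y) = X` for `y = e ^ X - 1`, up to the order of truncation. -/
theorem X_pow_dvd_log_exp_sub (n : ℕ) :
    (PowerSeries.X : PowerSeries ℝ) ^ (n + 1) ∣
      (∑ m ∈ Finset.range n, ((-1 : ℝ) ^ m / ((m : ℝ) + 1)) • (PowerSeries.exp ℝ - 1) ^ (m + 1))
        - PowerSeries.X := by
  set y : PowerSeries ℝ := PowerSeries.exp ℝ - 1 with hy
  have hXy : (PowerSeries.X : PowerSeries ℝ) ∣ y := by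
    rw [PowerSeries.X_dvd_iff]; simp [hy]
  set L := ∑ m ∈ Finset.range n, ((-1 : ℝ) ^ m / ((m : ℝ) + 1)) • y ^ (m + 1) with hL
  -- Since y' = 1 + y, the derivative of `L` is (1 + y) times a geometric sum in -y, which
  -- telescopes. Its defect has order n, and integrating gains one order.
  have hder : PowerSeries.derivative ℝ (L - PowerSeries.X) = - (-y) ^ n := by
    have h1 : PowerSeries.derivative ℝ y = 1 + y := by
      rw [hy, map_sub, PowerSeries.derivative_exp]; simp
    have h2 : PowerSeries.derivative ℝ L = 1 - (-y) ^ n := by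
      rw [hL, map_sum, ← mul_neg_geom_sum, sub_neg_eq_add, Finset.mul_sum]
      refine Finset.sum_congr rfl fun m _ => ?_
      rw [Derivation.map_smul, Derivation.leibniz_pow, h1]
      have : (m : ℝ) + 1 ≠ 0 := by positivity
      have h3 : ((-1 : ℝ) ^ m / ((m : ℝ) + 1)) • (((m + 1 : ℕ) : PowerSeries ℝ))
          = (-1 : PowerSeries ℝ) ^ m := by
        rw [Algebra.smul_def, ← map_natCast (algebraMap ℝ (PowerSeries ℝ)), ← map_mul]
        rw [Nat.cast_succ, div_mul_cancel₀ _ this, map_pow, map_neg, map_one]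
      rw [← Nat.cast_smul_eq_nsmul (PowerSeries ℝ), ← smul_assoc, h3, neg_pow y m]
      simp only [Nat.add_sub_cancel, smul_eq_mul]
      ring
    rw [map_sub, h2]
    simp
  rw [PowerSeries.X_pow_dvd_iff]
  intro m hm
  rcases m with _ | m
  · have h0 : PowerSeries.X ∣ L - PowerSeries.X := by
      refine dvd_sub (Finset.dvd_sum fun m _ => ?_) dvd_rfl
      exact dvd_smul_of_dvd _ (hXy.trans (dvd_pow_self y (Nat.succ_ne_zero m)))
    have := (PowerSeries.X_dvd_iff).1 h0
    simpa using this
  · have h1 : PowerSeries.coeff m (PowerSeries.derivative ℝ (L - PowerSeries.X)) = 0 := by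
      rw [hder, map_neg, neg_eq_zero]
      have : PowerSeries.X ^ n ∣ (-y) ^ n := pow_dvd_pow_of_dvd (hXy.neg_right) n
      exact (PowerSeries.X_pow_dvd_iff.1 this) m (by omega)
    rw [PowerSeries.coeff_derivative] at h1
    have : (m : ℝ) + 1 ≠ 0 := by positivity
    exact (mul_eq_zero.1 h1).resolve_right this

theorem coe_smul_poly (c : ℝ) (p : ℝ[X]) : ((c • p : ℝ[X]) : PowerSeries ℝ) = c • (p : PowerSeries ℝ) := by
  ext n; simp

/-- For y = e^X - 1 and t = (1 - e^(-X)) / X one has X t e^X = y. Hence X (g t - 1) e^X = g y - X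
e^X, which by the logarithm identity has order s + 2; cancelling X and the unit e^X leaves order s +
1. Truncating the exponential and t changes nothing below that order. -/
theorem X_pow_dvd_bchPoly_mul_sub_one (s : ℕ) :
    (X : ℝ[X]) ^ (s + 1) ∣ bchPoly s * leftDexpPoly s - 1 := by
  set e := PowerSeries.exp ℝ with he
  set y : PowerSeries ℝ := e - 1 with hy
  set g : PowerSeries ℝ :=
    1 + ∑ m ∈ Finset.Icc 1 s, ((-1 : ℝ) ^ (m + 1) / ((m : ℝ) * ((m : ℝ) + 1))) • y ^ m with hg
  set t : PowerSeries ℝ := PowerSeries.mk fun k => (-1 : ℝ) ^ k / ((k + 1).factorial : ℝ) with ht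
  have hXy : (PowerSeries.X : PowerSeries ℝ) ∣ y := by
    rw [PowerSeries.X_dvd_iff]; simp [hy, he]
  have hE : (PowerSeries.X : PowerSeries ℝ) ^ (s + 1) ∣ (expPoly s : PowerSeries ℝ) - e := by
    rw [PowerSeries.X_pow_dvd_iff]
    intro m hm
    simp [expPoly, he, Polynomial.coeff_X_pow, PowerSeries.coeff_exp, hm]
  have hT : (PowerSeries.X : PowerSeries ℝ) ^ (s + 1) ∣ (leftDexpPoly s : PowerSeries ℝ) - t := by
    rw [PowerSeries.X_pow_dvd_iff]
    intro m hm
    simp [leftDexpPoly, ht, Polynomial.coeff_X_pow, hm]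
  have hG : (PowerSeries.X : PowerSeries ℝ) ^ (s + 1) ∣ (bchPoly s : PowerSeries ℝ) - g := by
    have : (bchPoly s : PowerSeries ℝ) - g = ∑ m ∈ Finset.Icc 1 s,
        ((-1 : ℝ) ^ (m + 1) / ((m : ℝ) * ((m : ℝ) + 1))) •
          (((expPoly s : PowerSeries ℝ) - 1) ^ m - y ^ m) := by
      simp only [bchPoly, hg, smul_sub, Finset.sum_sub_distrib, Polynomial.coe_add,
        Polynomial.coe_one, add_sub_add_left_eq_sub]
      congr 1
      rw [← Polynomial.coeToPowerSeries.ringHom_apply, map_sum]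
      simp only [Polynomial.coeToPowerSeries.ringHom_apply, coe_smul_poly, Polynomial.coe_pow,
        Polynomial.coe_sub, Polynomial.coe_one]
    rw [this]
    refine Finset.dvd_sum fun m _ => dvd_smul_of_dvd _ ?_
    refine dvd_trans ?_ (sub_dvd_pow_sub_pow _ _ m)
    simpa [hy] using hE
  have hte : PowerSeries.X * t * e = y := by
    have h1 : PowerSeries.X * t = 1 - PowerSeries.evalNegHom e := by
      ext n
      rcases n with _ | n
      · rw [map_sub, PowerSeries.evalNegHom, PowerSeries.coeff_rescale, he, PowerSeries.coeff_exp]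
        simp
      · rw [mul_comm, PowerSeries.coeff_succ_mul_X]
        simp [ht, he, PowerSeries.evalNegHom, PowerSeries.coeff_exp, PowerSeries.coeff_one, pow_succ]
        ring
    rw [h1, sub_mul, one_mul, mul_comm _ e, he, PowerSeries.exp_mul_exp_neg_eq_one, hy]
  have hmain : (PowerSeries.X : PowerSeries ℝ) ^ (s + 1) ∣ g * t - 1 := by
    have h1 : (PowerSeries.X : PowerSeries ℝ) * PowerSeries.X ^ (s + 1) ∣
        PowerSeries.X * ((g * t - 1) * e) := by
      have h2 := bch_mul_eq_log y s
      rw [← hg] at h2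
      set L := ∑ m ∈ Finset.range (s + 1), ((-1 : ℝ) ^ m / ((m : ℝ) + 1)) • y ^ (m + 1) with hL
      have h3 : PowerSeries.X * ((g * t - 1) * e) = e * (L - PowerSeries.X)
          + ((-1 : ℝ) ^ (s + 1) / ((s : ℝ) + 1)) • y ^ (s + 2) := by
        have h4 : (1 + y) = e := by rw [hy]; ring
        rw [h4] at h2
        linear_combination g * hte + h2
      rw [h3, ← pow_succ']
      exact dvd_add ((X_pow_dvd_log_exp_sub (s + 1)).mul_left _)
        (dvd_smul_of_dvd _ (pow_dvd_pow_of_dvd hXy _))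
    have h5 := (mul_dvd_mul_iff_left PowerSeries.X_ne_zero).1 h1
    have h6 : g * t - 1 = (g * t - 1) * e * PowerSeries.evalNegHom e := by
      rw [mul_assoc, he, PowerSeries.exp_mul_exp_neg_eq_one, mul_one]
    rw [h6]
    exact h5.mul_right _
  have hfin : (PowerSeries.X : PowerSeries ℝ) ^ (s + 1) ∣
      ((bchPoly s * leftDexpPoly s - 1 : ℝ[X]) : PowerSeries ℝ) := by
    rw [Polynomial.coe_sub, Polynomial.coe_mul, Polynomial.coe_one]
    have : (bchPoly s : PowerSeries ℝ) * (leftDexpPoly s : PowerSeries ℝ) - 1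
        = ((bchPoly s : PowerSeries ℝ) - g) * (leftDexpPoly s : PowerSeries ℝ)
          + g * ((leftDexpPoly s : PowerSeries ℝ) - t) + (g * t - 1) := by ring
    rw [this]
    exact dvd_add (dvd_add (hG.mul_right _) (hT.mul_left _)) hmain
  rw [Polynomial.X_pow_dvd_iff]
  intro d hd
  have := (PowerSeries.X_pow_dvd_iff.1 hfin) d hd
  rwa [Polynomial.coeff_coe] at this

end PowerSeriesIdentity

variable {𝔤 : Type*} [LieRing 𝔤] [LieAlgebra ℝ 𝔤]

theorem aeval_ad_expPoly (s : ℕ) (x : 𝔤) :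
    Polynomial.aeval (LieAlgebra.ad ℝ 𝔤 x) (expPoly s) = expAd s x := by
  simp [expPoly, expAd]

theorem aeval_ad_bchPoly (s : ℕ) (x : 𝔤) :
    Polynomial.aeval (LieAlgebra.ad ℝ 𝔤 x) (bchPoly s) = bchSeries s (expAd s x) := by
  simp [bchPoly, bchSeries, aeval_ad_expPoly]

/-- `(1 - e ^ (-ad x)) / ad x` inverts `ad x / (1 - e ^ (-ad x))`. -/
theorem IsTypeIIFiliform.leftDexp_bchSeries {s : ℕ} {X : Module.Basis (Fin (s + 1)) ℝ 𝔤}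
    (hX : IsTypeIIFiliform s X) (x v : 𝔤) :
    ∑ k ∈ Finset.range (s + 1), ((-1 : ℝ) ^ k / ((k + 1).factorial : ℝ)) •
      ((LieAlgebra.ad ℝ 𝔤 x) ^ k) (bchSeries s (expAd s x) v) = v := by
  have h1 : Polynomial.aeval (LieAlgebra.ad ℝ 𝔤 x) (leftDexpPoly s * bchPoly s) = 1 := by
    have h2 : Polynomial.aeval (LieAlgebra.ad ℝ 𝔤 x) (bchPoly s * leftDexpPoly s - 1) = 0 :=
      Polynomial.aeval_eq_zero_of_dvd_aeval_eq_zero (X_pow_dvd_bchPoly_mul_sub_one s)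
        (by simpa using hX.ad_pow_eq_zero x)
    rw [mul_comm]
    rw [map_sub, map_one, sub_eq_zero] at h2
    exact h2
  rw [map_mul, aeval_ad_bchPoly] at h1
  have h3 := LinearMap.congr_fun h1 v
  simpa [leftDexpPoly] using h3

end Carnot

/-! ### The derivative of the exponential in a Banach algebra -/

namespace Carnot

section Exponential

open Filter Topology NormedSpace

variable {𝔸 : Type*} [NormedRing 𝔸] [NormedAlgebra ℝ 𝔸] [CompleteSpace 𝔸]

theorem continuous_exp_real_algebra : Continuous (exp : 𝔸 → 𝔸) :=
  continuous_iff_continuousAt.2 fun x => (exp_analytic (𝕂 := ℝ) x).continuousAt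

theorem exp_neg_mul_exp (x : 𝔸) : exp (-x) * exp x = 1 := by
  let : NormedAlgebra ℚ 𝔸 := NormedAlgebra.restrictScalars ℚ ℝ 𝔸
  rw [← exp_add_of_commute (Commute.neg_left (Commute.refl x)), neg_add_cancel, exp_zero]

theorem exp_mul_exp_neg (x : 𝔸) : exp x * exp (-x) = 1 := by
  simpa using exp_neg_mul_exp (-x)

/-- Duhamel's formula. -/
theorem exp_sub_exp_eq_integral (a b : 𝔸) :
    exp b - exp a = (∫ t in (0 : ℝ)..1, exp (t • b) * (b - a) * exp (t • -a)) * exp a := by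
  have hd : ∀ t : ℝ, HasDerivAt (fun t : ℝ => exp (t • b) * exp (t • -a))
      (exp (t • b) * (b - a) * exp (t • -a)) t := by
    intro t
    convert! (hasDerivAt_exp_smul_const b t).mul (hasDerivAt_exp_smul_const' (-a) t) using 1
    noncomm_ring
  have hc : Continuous fun t : ℝ => exp (t • b) * (b - a) * exp (t • -a) := by
    have := continuous_exp_real_algebra (𝔸 := 𝔸)
    fun_prop
  rw [intervalIntegral.integral_eq_sub_of_hasDerivAt (fun t _ => hd t) (hc.intervalIntegrable 0 1)]
  simp [sub_mul, mul_assoc, exp_neg_mul_exp]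

/-- Duhamel's formula for `a` and `a + ε • d` writes the difference quotient as an integral
depending continuously on ε, so the limit is its value at ε = 0. -/
theorem hasDerivAt_exp_add_smul (a d : 𝔸) :
    HasDerivAt (fun ε : ℝ => exp (a + ε • d))
      ((∫ t in (0 : ℝ)..1, exp (t • a) * d * exp (t • -a)) * exp a) 0 := by
  have hexp := continuous_exp_real_algebra (𝔸 := 𝔸)
  have hK : Continuous fun ε : ℝ =>
      (∫ t in (0 : ℝ)..1, exp (t • (a + ε • d)) * d * exp (t • -a)) * exp a := by
    refine Continuous.mul ?_ continuous_const
    refine intervalIntegral.continuous_parametric_intervalIntegral_of_continuous' ?_ 0 1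
    unfold Function.uncurry
    fun_prop
  rw [hasDerivAt_iff_tendsto_slope_zero]
  have h0 := (hK.tendsto 0).mono_left (nhdsWithin_le_nhds (s := {0}ᶜ))
  simp only [zero_smul, add_zero] at h0 ⊢
  refine h0.congr' ?_
  filter_upwards [self_mem_nhdsWithin] with ε hε
  have hε' : ε ≠ 0 := hε
  rw [zero_add, exp_sub_exp_eq_integral a (a + ε • d), add_sub_cancel_left]
  simp only [mul_smul_comm, smul_mul_assoc]
  rw [intervalIntegral.integral_smul, smul_mul_assoc, smul_smul, inv_mul_cancel₀ hε', one_smul]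

theorem hasDerivAt_neg_pow_div_factorial (k : ℕ) (t : ℝ) :
    HasDerivAt (fun t : ℝ => (-t) ^ (k + 1) / ((k + 1).factorial : ℝ))
      (-((-t) ^ k / (k.factorial : ℝ))) t := by
  convert! (((hasDerivAt_id t).neg.pow (k + 1)).div_const ((k + 1).factorial : ℝ)) using 1
  have h1 : (k.factorial : ℝ) ≠ 0 := by positivity
  have h2 : (k : ℝ) + 1 ≠ 0 := by positivity
  simp only [Nat.factorial_succ, id, Nat.add_sub_cancel, Nat.cast_mul, Nat.cast_succ, Pi.neg_apply]
  field_simp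

/-- Conjugation by `exp (t b)` is the exponential of the inner derivation, when it acts
nilpotently. -/
theorem exp_conj_eq_sum (b : 𝔸) (d : ℕ → 𝔸) (n : ℕ) (hd : ∀ k, b * d k - d k * b = d (k + 1))
    (hn : d (n + 1) = 0) (t : ℝ) :
    exp (t • -b) * d 0 * exp (t • b)
      = ∑ k ∈ Finset.range (n + 1), ((-t) ^ k / (k.factorial : ℝ)) • d k := by
  set S : ℝ → 𝔸 := fun t => ∑ k ∈ Finset.range (n + 1), ((-t) ^ k / (k.factorial : ℝ)) • d k with hS
  have hS' : ∀ t, HasDerivAt S (-(b * S t - S t * b)) t := by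
    intro t
    have h1 : b * S t - S t * b
        = ∑ k ∈ Finset.range n, ((-t) ^ k / (k.factorial : ℝ)) • d (k + 1) := by
      simp only [hS, Finset.mul_sum, Finset.sum_mul, ← Finset.sum_sub_distrib, mul_smul_comm,
        smul_mul_assoc, ← smul_sub, hd]
      rw [Finset.sum_range_succ, hn, smul_zero, add_zero]
    have h2 : S = fun t => (∑ k ∈ Finset.range n,
        ((-t) ^ (k + 1) / ((k + 1).factorial : ℝ)) • d (k + 1)) + d 0 := by
      funext t
      simp [hS, Finset.sum_range_succ']
    rw [h1, ← Finset.sum_neg_distrib, h2]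
    refine HasDerivAt.add_const _ (HasDerivAt.fun_sum fun k _ => ?_)
    rw [← neg_smul]
    exact (hasDerivAt_neg_pow_div_factorial k t).smul_const _
  -- The finite sum solves the Lax equation S' = -[b, S], so undoing the conjugation gives a
  -- constant.
  have hconst : ∀ t, exp (t • b) * S t * exp (t • -b) = d 0 := by
    have hder : ∀ t, HasDerivAt (fun t : ℝ => exp (t • b) * S t * exp (t • -b)) 0 t := by
      intro t
      convert! ((hasDerivAt_exp_smul_const b t).mul (hS' t)).mul
        (hasDerivAt_exp_smul_const' (-b) t) using 1
      simp only [Pi.mul_apply, mul_sub, sub_mul, neg_sub, add_mul, mul_assoc, neg_mul, mul_neg]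
      abel
    intro t
    have := is_const_of_deriv_eq_zero (fun t => (hder t).differentiableAt)
      (fun t => (hder t).deriv) t 0
    simp only [zero_smul, exp_zero, one_mul, mul_one] at this
    rw [this]
    simp only [hS]
    rw [Finset.sum_range_succ']
    simp
  rw [← hconst t, smul_neg]
  have h1 : exp (-(t • b)) * exp (t • b) = 1 := exp_neg_mul_exp _
  calc exp (-(t • b)) * (exp (t • b) * S t * exp (-(t • b))) * exp (t • b)
      = (exp (-(t • b)) * exp (t • b)) * S t * (exp (-(t • b)) * exp (t • b)) := by noncomm_ring
    _ = S t := by rw [h1]; simp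

theorem integral_exp_conj (b : 𝔸) (d : ℕ → 𝔸) (n : ℕ) (hd : ∀ k, b * d k - d k * b = d (k + 1))
    (hn : d (n + 1) = 0) :
    ∫ t in (0 : ℝ)..1, exp (t • -b) * d 0 * exp (t • b)
      = ∑ k ∈ Finset.range (n + 1), ((-1 : ℝ) ^ k / ((k + 1).factorial : ℝ)) • d k := by
  have h1 : ∀ t : ℝ, HasDerivAt (fun t : ℝ => ∑ k ∈ Finset.range (n + 1),
      (-((-t) ^ (k + 1) / ((k + 1).factorial : ℝ))) • d k) (exp (t • -b) * d 0 * exp (t • b)) t := by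
    intro t
    rw [exp_conj_eq_sum b d n hd hn t]
    refine HasDerivAt.fun_sum fun k _ => ?_
    convert! ((hasDerivAt_neg_pow_div_factorial k t).neg).smul_const (d k) using 1
    rw [neg_neg]
  have hc : Continuous fun t : ℝ => exp (t • -b) * d 0 * exp (t • b) := by
    have := continuous_exp_real_algebra (𝔸 := 𝔸)
    fun_prop
  rw [intervalIntegral.integral_eq_sub_of_hasDerivAt (fun t _ => h1 t) (hc.intervalIntegrable 0 1)]
  rw [← Finset.sum_sub_distrib]
  refine Finset.sum_congr rfl fun k _ => ?_
  rw [← sub_smul]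
  congr 1
  simp [pow_succ, neg_div]

end Exponential

variable {𝔤 : Type*} [LieRing 𝔤] [LieAlgebra ℝ 𝔤]

/-! ### The differential of left translation in exponential coordinates -/

section LeftTranslation

/-- Because the vector argument vanishes at the base point, continuity of `K` there replaces the
differentiability that a product rule would require. -/
theorem hasFDerivAt_apply_self_zero {E : Type*} [NormedAddCommGroup E] [NormedSpace ℝ E]
    {K : E → E →L[ℝ] E} (hK : ContinuousAt K 0) :
    HasFDerivAt (fun q => K q q) (K 0) 0 := by
  rw [hasFDerivAt_iff_isLittleO_nhds_zero]
  have h1 : (fun h => K (0 + h) (0 + h) - K 0 0 - K 0 h) = fun h => (K h - K 0) h := by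
    funext h; simp
  rw [h1]
  have h2 : (fun h => K h - K 0) =o[nhds 0] fun _ => (1 : ℝ) := by
    rw [Asymptotics.isLittleO_one_iff]
    have := hK.tendsto.sub_const (K 0)
    simpa using this
  have h3 : (fun h => (K h - K 0) h) =O[nhds 0] fun h : E => ‖K h - K 0‖ * ‖h‖ :=
    Asymptotics.IsBigO.of_bound 1 (Filter.Eventually.of_forall fun h => by
      simpa using (K h - K 0).le_opNorm h)
  refine h3.trans_isLittleO ?_
  have := h2.norm_left.mul_isBigO (Asymptotics.isBigO_refl (fun h : E => ‖h‖) (nhds 0))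
  exact Asymptotics.isLittleO_norm_right.1 (by simpa using this)

/-- Endomorphisms of `𝔤` as operators on the coordinate space. -/
noncomputable def coordEnd {n : ℕ} (X : Module.Basis (Fin n) ℝ 𝔤) :
    Module.End ℝ 𝔤 ≃ₐ[ℝ] ((Fin n → ℝ) →L[ℝ] (Fin n → ℝ)) :=
  (X.equivFun.conjAlgEquiv ℝ).trans (Module.End.toContinuousLinearMap _)

theorem coordEnd_apply {n : ℕ} (X : Module.Basis (Fin n) ℝ 𝔤) (A : Module.End ℝ 𝔤)
    (v : Fin n → ℝ) : coordEnd X A v = X.equivFun (A (X.equivFun.symm v)) := rfl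

theorem continuous_coordEnd_expAd (s : ℕ) {n : ℕ} (X : Module.Basis (Fin n) ℝ 𝔤) :
    Continuous fun q : Fin n → ℝ => coordEnd X (expAd s (X.equivFun.symm q)) := by
  have h1 : Continuous fun q : Fin n → ℝ => coordEnd X (LieAlgebra.ad ℝ 𝔤 (X.equivFun.symm q)) :=
    LinearMap.continuous_of_finiteDimensional
      ((coordEnd X).toLinearMap ∘ₗ (LieAlgebra.ad ℝ 𝔤 : 𝔤 →ₗ[ℝ] Module.End ℝ 𝔤)
        ∘ₗ X.equivFun.symm.toLinearMap)
  simp only [expAd, map_sum, map_smul, map_pow]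
  fun_prop

theorem leftTranslationDeriv_apply (s : ℕ) {n : ℕ} (X : Module.Basis (Fin n) ℝ 𝔤)
    (p v : Fin n → ℝ) :
    leftTranslationDeriv s X p v
      = X.equivFun (bchSeries s (expAd s (X.equivFun.symm p)) (X.equivFun.symm v)) := by
  set M : (Fin n → ℝ) → (Fin n → ℝ) →L[ℝ] (Fin n → ℝ) := fun q =>
    coordEnd X (bchSeries s (expAd s (X.equivFun.symm p) * expAd s (X.equivFun.symm q))) with hM
  have hMc : Continuous M := by
    have := continuous_coordEnd_expAd s X
    simp only [hM, bchSeries, map_add, map_one, map_sum, map_smul, map_pow, map_sub, map_mul]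
    fun_prop
  -- The integrand of the group law is linear in its last argument `q`; the remaining dependence on
  -- `q` goes into the operator `K q`, so that the product is p + K q q.
  set K : (Fin n → ℝ) → (Fin n → ℝ) →L[ℝ] (Fin n → ℝ) := fun q =>
    ∫ t in (0 : ℝ)..1, M (t • q) with hKdef
  have hK : Continuous K := by
    refine intervalIntegral.continuous_parametric_intervalIntegral_of_continuous' ?_ 0 1
    unfold Function.uncurry
    fun_prop
  have h1 : (fun q => groupMul s X p q) = fun q => p + K q q := by
    funext q
    have hi : IntervalIntegrable (fun t : ℝ => M (t • q)) volume 0 1 :=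
      Continuous.intervalIntegrable (by fun_prop) _ _
    rw [hKdef]
    simp only
    rw [ContinuousLinearMap.intervalIntegral_apply hi]
    simp only [groupMul, hM, coordEnd_apply, map_smul]
  have h0 : expAd s (0 : 𝔤) = 1 := by
    simp [expAd, Finset.sum_range_succ']
  have hK0 : K 0 = M 0 := by simp [hKdef]
  rw [leftTranslationDeriv, h1,
    ((hasFDerivAt_apply_self_zero hK.continuousAt).const_add p).fderiv, hK0]
  simp [hM, coordEnd_apply, h0]

end LeftTranslation

/-! ### The frame along horizontal directions -/

section Frame

theorem mul_neg_sub_neg_mul {A : Type*} [Ring A] (a b : A) :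
    a * -b - -b * a = -(a * b - b * a) := by
  noncomm_ring

/-- The linear model, as a representation by bounded operators. -/
noncomputable def repL (s : ℕ) (X : Module.Basis (Fin (s + 1)) ℝ 𝔤) :
    𝔤 →ₗ[ℝ] ((Fin (s + 2) → ℝ) →L[ℝ] (Fin (s + 2) → ℝ)) :=
  (Module.End.toContinuousLinearMap (Fin (s + 2) → ℝ)).toLinearMap ∘ₗ rep s X

theorem repL_apply (s : ℕ) (X : Module.Basis (Fin (s + 1)) ℝ 𝔤) (x : 𝔤) (f : Fin (s + 2) → ℝ) :
    repL s X x f = rep s X x f := rfl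

theorem IsTypeIIFiliform.repL_lie {s : ℕ} (hs : 5 ≤ s) {X : Module.Basis (Fin (s + 1)) ℝ 𝔤}
    (hX : IsTypeIIFiliform s X) (x y : 𝔤) :
    repL s X ⁅x, y⁆ = repL s X x * repL s X y - repL s X y * repL s X x := by
  simp only [repL, LinearMap.comp_apply, hX.rep_lie hs, map_sub]
  simp

/-- The inverse of the group element with exponential coordinates `p`, acting on the model. -/
noncomputable def frame (s : ℕ) (X : Module.Basis (Fin (s + 1)) ℝ 𝔤) (p : Fin (s + 1) → ℝ) :
    (Fin (s + 2) → ℝ) →L[ℝ] (Fin (s + 2) → ℝ) :=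
  NormedSpace.exp (-repL s X (X.equivFun.symm p))

theorem contDiff_frame (s : ℕ) (X : Module.Basis (Fin (s + 1)) ℝ 𝔤) : ContDiff ℝ 1 (frame s X) := by
  have h1 : ContDiff ℝ 1 (fun p : Fin (s + 1) → ℝ => -repL s X (X.equivFun.symm p)) :=
    (LinearMap.toContinuousLinearMap
      (-(repL s X ∘ₗ X.equivFun.symm.toLinearMap))).contDiff
  have h2 : ContDiff ℝ 1 (NormedSpace.exp : ((Fin (s + 2) → ℝ) →L[ℝ] (Fin (s + 2) → ℝ)) → _) :=
    contDiff_iff_contDiffAt.2 fun x => (NormedSpace.exp_analytic (𝕂 := ℝ) x).contDiffAt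
  exact h2.comp h1

/-- Passing to inverses turns the left-invariant field into multiplication by a fixed operator on
the left. The derivative of the exponential contributes (1 - e^(-ad x)) / ad x applied to `w`, and
`w` is ad x / (1 - e^(-ad x)) applied to `v`, so only `v` remains. -/
theorem IsTypeIIFiliform.fderiv_frame_leftTranslationDeriv {s : ℕ} (hs : 5 ≤ s)
    {X : Module.Basis (Fin (s + 1)) ℝ 𝔤} (hX : IsTypeIIFiliform s X) (p v : Fin (s + 1) → ℝ) :
    fderiv ℝ (frame s X) p (leftTranslationDeriv s X p v)
      = -repL s X (X.equivFun.symm v) * frame s X p := by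
  set x := X.equivFun.symm p with hx
  set w := bchSeries s (expAd s x) (X.equivFun.symm v) with hw
  have hdir : leftTranslationDeriv s X p v = X.equivFun w := leftTranslationDeriv_apply s X p v
  rw [hdir]
  have hline : HasDerivAt (fun ε : ℝ => p + ε • X.equivFun w) (X.equivFun w) 0 := by
    simpa using ((hasDerivAt_id (0 : ℝ)).smul_const (X.equivFun w)).const_add p
  have hfd : HasFDerivAt (frame s X) (fderiv ℝ (frame s X) p) (p + (0 : ℝ) • X.equivFun w) := by
    simpa using ((contDiff_frame s X).differentiable one_ne_zero p).hasFDerivAt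
  have h1 := hfd.comp_hasDerivAt (0 : ℝ) hline
  have h2 : (frame s X ∘ fun ε : ℝ => p + ε • X.equivFun w)
      = fun ε : ℝ => NormedSpace.exp (-repL s X x + ε • -repL s X w) := by
    funext ε
    simp only [Function.comp, frame, map_add, map_smul, LinearEquiv.symm_apply_apply, hx, smul_neg,
      neg_add]
  rw [h2] at h1
  rw [h1.unique (hasDerivAt_exp_add_smul _ _)]
  congr 1
  have h3 := integral_exp_conj (repL s X x)
    (fun k => -repL s X (((LieAlgebra.ad ℝ 𝔤 x) ^ k) w)) s
    (fun k => by
      rw [pow_succ', Module.End.mul_apply, LieAlgebra.ad_apply, hX.repL_lie hs]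
      exact mul_neg_sub_neg_mul _ _)
    (by simp [hX.ad_pow_eq_zero x])
  simp only [pow_zero, Module.End.one_apply] at h3
  simp only [neg_neg]
  rw [h3]
  have h4 := congrArg (repL s X) (hX.leftDexp_bchSeries x (X.equivFun.symm v))
  simp only [map_sum, map_smul, ← hw] at h4
  simp only [smul_neg, Finset.sum_neg_distrib, h4]

end Frame

end Carnot

/-! ### Global coordinates from the orbit of the base state -/

namespace Carnot

/-- A `C¹` map which is triangular, with constant nonzero diagonal coefficients, has a
`C¹` inverse. -/
theorem exists_contDiff_inverse_of_triangular {n : ℕ} {f : (Fin n → ℝ) → (Fin n → ℝ)} (c : Fin n → ℝ)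
    (hc : ∀ i, c i ≠ 0) (hf : ContDiff ℝ 1 f)
    (h : ∀ (i : Fin n) (p q : Fin n → ℝ), (∀ j < i, p j = q j) →
      f p i - f q i = c i * (p i - q i)) :
    ∃ g : (Fin n → ℝ) → (Fin n → ℝ), ContDiff ℝ 1 g ∧ (∀ y, f (g y) = y) ∧ ∀ p, g (f p) = p := by
  -- Forward substitution as a fixed-point iteration: solutions of f p = y are the fixed points of
  -- `T y`, and each iteration makes one more coordinate independent of the starting point. After
  -- `n` iterations the result is exact, and it is C¹ in `y` as a finite composition.
  set T : (Fin n → ℝ) → (Fin n → ℝ) → (Fin n → ℝ) := fun y p i => p i + (y i - f p i) / c i with hT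
  have hTc : ∀ (k : ℕ) y p q, ∀ i : Fin n, (i : ℕ) < k → (T y)^[k] p i = (T y)^[k] q i := by
    intro k y p q
    induction k with
    | zero => intro i hi; omega
    | succ k ih =>
      intro i hi
      rw [Function.iterate_succ_apply', Function.iterate_succ_apply']
      have h1 := h i ((T y)^[k] p) ((T y)^[k] q) fun j hj => ih j (by
        have : (j : ℕ) < i := hj
        omega)
      simp only [hT] at h1 ⊢
      field_simp [hc i]
      linear_combination -h1
  have hfix : ∀ y p, (T y)^[n + 1] p = (T y)^[n] p := by
    intro y p
    rw [Function.iterate_succ_apply]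
    funext i
    exact hTc n y _ _ i i.2
  refine ⟨fun y => (T y)^[n] 0, ?_, ?_, ?_⟩
  · have : ∀ k : ℕ, ContDiff ℝ 1 fun y => (T y)^[k] 0 := by
      intro k
      induction k with
      | zero => exact contDiff_const
      | succ k ih =>
        simp only [Function.iterate_succ_apply']
        rw [contDiff_pi]
        intro i
        have h2 : ContDiff ℝ 1 fun y => f ((T y)^[k] 0) := hf.comp ih
        exact ((contDiff_pi.1 ih i).add
          (((contDiff_apply ℝ ℝ i).sub (contDiff_pi.1 h2 i)).div_const _))
    exact this n
  · intro y
    have h1 := hfix y 0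
    rw [Function.iterate_succ_apply'] at h1
    funext i
    have h2 := congrFun h1 i
    simp only [hT] at h2
    have h3 : (y i - f ((T y)^[n] 0) i) / c i = 0 := by
      simpa [hT] using h2
    rw [div_eq_zero_iff, or_iff_left (hc i), sub_eq_zero] at h3
    exact h3.symm
  · intro p
    have h1 : T (f p) p = p := by
      funext i
      simp [hT]
    have h2 : (T (f p))^[n] p = p := Function.iterate_fixed h1 n
    funext i
    conv_rhs => rw [← h2]
    exact hTc n (f p) 0 p i i.2

variable {𝔤 : Type*} [LieRing 𝔤] [LieAlgebra ℝ 𝔤]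

theorem rep_symm_apply (s : ℕ) (X : Module.Basis (Fin (s + 1)) ℝ 𝔤) (p : Fin (s + 1) → ℝ)
    (f : Fin (s + 2) → ℝ) (k : Fin (s + 2)) :
    rep s X (X.equivFun.symm p) f k = ∑ j, p j * modelOp s j f k := by
  simp [Module.Basis.equivFun_symm_apply, rep_basis]

theorem rep_apply_zero (s : ℕ) (X : Module.Basis (Fin (s + 1)) ℝ 𝔤) (x : 𝔤)
    (f : Fin (s + 2) → ℝ) : rep s X x f 0 = 0 := by
  obtain ⟨p, rfl⟩ := X.equivFun.symm.surjective x
  rw [rep_symm_apply]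
  simp [modelOp_apply_zero]

theorem hasSum_exp_apply {n : ℕ} (A : (Fin n → ℝ) →L[ℝ] (Fin n → ℝ)) (f : Fin n → ℝ) (k : Fin n) :
    HasSum (fun m : ℕ => ((m.factorial : ℝ)⁻¹) * (A ^ m) f k) (NormedSpace.exp A f k) := by
  have h1 := NormedSpace.exp_series_hasSum_exp' (𝕂 := ℝ) A
  have h2 := ((ContinuousLinearMap.proj (R := ℝ) (φ := fun _ : Fin n => ℝ) k).comp
    (ContinuousLinearMap.apply ℝ (Fin n → ℝ) f)).hasSum h1
  exact h2

theorem exp_repL_apply_zero (s : ℕ) (X : Module.Basis (Fin (s + 1)) ℝ 𝔤) (x : 𝔤)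
    (f : Fin (s + 2) → ℝ) : NormedSpace.exp (repL s X x) f 0 = f 0 := by
  have h1 := hasSum_exp_apply (repL s X x) f 0
  refine h1.unique ?_
  convert! hasSum_single (f := fun m : ℕ => ((m.factorial : ℝ)⁻¹) * ((repL s X x) ^ m) f 0) 0 ?_ using 1
  · simp
  · intro m hm
    obtain ⟨k, rfl⟩ := Nat.exists_eq_succ_of_ne_zero hm
    rw [pow_succ', mul_apply_eq_comp, repL_apply, rep_apply_zero, mul_zero]

theorem frame_apply_zero (s : ℕ) (X : Module.Basis (Fin (s + 1)) ℝ 𝔤) (p : Fin (s + 1) → ℝ)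
    (f : Fin (s + 2) → ℝ) : frame s X p f 0 = f 0 := by
  rw [frame, ← map_neg]
  exact exp_repL_apply_zero s X _ f

/-- In entry `i.succ`, the parameter `p i` acts only through the constant entry of the previous
iterate, and that entry vanishes after the first application. So `p i` enters the exponential series
linearly, in degree one; all other terms involve lower-index parameters. -/
theorem rep_pow_apply_congr (s : ℕ) (X : Module.Basis (Fin (s + 1)) ℝ 𝔤) (m : ℕ) (i : Fin (s + 1))
    (p q : Fin (s + 1) → ℝ) (h : ∀ j < i, p j = q j) :
    ((-repL s X (X.equivFun.symm p)) ^ m) (Pi.single 0 1) i.succ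
      - ((-repL s X (X.equivFun.symm q)) ^ m) (Pi.single 0 1) i.succ
      = if m = 1 then -modelDiag s i * (p i - q i) else 0 := by
  induction m generalizing i with
  | zero => simp
  | succ m ih =>
    set f := ((-repL s X (X.equivFun.symm p)) ^ m) (Pi.single 0 1) with hf
    set g := ((-repL s X (X.equivFun.symm q)) ^ m) (Pi.single 0 1) with hg
    have hzero : ∀ r : Fin (s + 1) → ℝ,
        ((-repL s X (X.equivFun.symm r)) ^ m) (Pi.single 0 1) 0 = if m = 0 then 1 else 0 := by
      intro r
      rcases m with _ | m
      · simp
      · rw [pow_succ', mul_apply_eq_comp, neg_apply, Pi.neg_apply,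
          repL_apply, rep_apply_zero]
        simp
    have hfg : ∀ k : Fin (s + 2), (k : ℕ) ≤ i → f k = g k := by
      intro k hk
      induction k using Fin.cases with
      | zero => rw [hf, hg, hzero, hzero]
      | succ k =>
        have hk' : (k : ℕ) < i := by simpa using hk
        have h1 := ih k fun j hj => h j (hj.trans hk')
        rw [h k hk', sub_self, mul_zero, ite_self, sub_eq_zero] at h1
        exact h1
    rw [pow_succ', pow_succ', mul_apply_eq_comp, mul_apply_eq_comp,
      neg_apply, neg_apply, Pi.neg_apply, Pi.neg_apply,
      repL_apply, repL_apply, rep_symm_apply, rep_symm_apply, ← hf, ← hg, neg_sub_neg,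
      ← Finset.sum_sub_distrib, Finset.sum_eq_single i]
    · rw [modelOp_apply_succ_self, modelOp_apply_succ_self, hf, hg, hzero, hzero]
      by_cases hm : m = 0
      · simp [hm]; ring
      · simp [hm]
    · intro j _ hj
      rcases lt_or_gt_of_ne hj with hj | hj
      · rw [h j hj, modelOp_apply_succ_congr i j f g hfg, sub_self]
      · rw [modelOp_apply_succ_of_lt i j hj, modelOp_apply_succ_of_lt i j hj]; simp
    · simp

/-- The coordinates of the model: the orbit of the base state. -/
noncomputable def modelCoord (s : ℕ) (X : Module.Basis (Fin (s + 1)) ℝ 𝔤) (p : Fin (s + 1) → ℝ) :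
    Fin (s + 1) → ℝ :=
  fun i => frame s X p (Pi.single 0 1) i.succ

theorem contDiff_modelCoord (s : ℕ) (X : Module.Basis (Fin (s + 1)) ℝ 𝔤) :
    ContDiff ℝ 1 (modelCoord s X) := by
  rw [contDiff_pi]
  intro i
  exact ((ContinuousLinearMap.proj (R := ℝ) (φ := fun _ : Fin (s + 2) => ℝ) i.succ).comp
    (ContinuousLinearMap.apply ℝ (Fin (s + 2) → ℝ) (Pi.single 0 1))).contDiff.comp
    (contDiff_frame s X)

theorem exists_contDiff_inverse_modelCoord (s : ℕ) (X : Module.Basis (Fin (s + 1)) ℝ 𝔤) :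
    ∃ g : (Fin (s + 1) → ℝ) → (Fin (s + 1) → ℝ), ContDiff ℝ 1 g ∧
      (∀ y, modelCoord s X (g y) = y) ∧ ∀ p, g (modelCoord s X p) = p := by
  refine exists_contDiff_inverse_of_triangular (fun i => -modelDiag s i)
    (fun i => neg_ne_zero.2 (modelDiag_ne_zero s i)) (contDiff_modelCoord s X) fun i p q h => ?_
  have h1 := (hasSum_exp_apply (-repL s X (X.equivFun.symm p)) (Pi.single 0 1) i.succ).sub
    (hasSum_exp_apply (-repL s X (X.equivFun.symm q)) (Pi.single 0 1) i.succ)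
  refine h1.unique ?_
  simp only [← mul_sub, rep_pow_apply_congr s X _ i p q h]
  convert! hasSum_single (f := fun m : ℕ => ((m.factorial : ℝ)⁻¹) *
    if m = 1 then -modelDiag s i * (p i - q i) else 0) 1 ?_ using 1
  · simp
  · intro m hm
    simp [hm]

theorem frame_apply_single (s : ℕ) (X : Module.Basis (Fin (s + 1)) ℝ 𝔤) (p : Fin (s + 1) → ℝ) :
    frame s X p (Pi.single 0 1) = Fin.cons 1 (modelCoord s X p) := by
  funext k
  induction k using Fin.cases with
  | zero => simp [frame_apply_zero]
  | succ k => rfl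

end Carnot

/-! ### Absolutely continuous curves -/

namespace Carnot

section AbsolutelyContinuous

open Filter Set

/-- The curve is bounded, and a C¹ map is Lipschitz on the compact convex ball containing it. -/
theorem _root_.AbsolutelyContinuousOnInterval.contDiff_comp {E F : Type*} [NormedAddCommGroup E]
    [NormedSpace ℝ E] [ProperSpace E] [NormedAddCommGroup F] [NormedSpace ℝ F] {f : ℝ → E} {a b : ℝ}
    (hf : AbsolutelyContinuousOnInterval f a b) {g : E → F} (hg : ContDiff ℝ 1 g) :
    AbsolutelyContinuousOnInterval (fun t => g (f t)) a b := by
  obtain ⟨C, hC⟩ := hf.exists_bound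
  obtain ⟨K, hK⟩ := (hg.contDiffOn (s := Metric.closedBall 0 C)).exists_lipschitzOnWith one_ne_zero
    (convex_closedBall _ _) (isCompact_closedBall _ _)
  refine squeeze_zero' (Eventually.of_forall fun E => Finset.sum_nonneg fun i _ => dist_nonneg) ?_
    (by simpa using Tendsto.const_mul (K : ℝ) hf)
  have h1 : ∀ᶠ E in AbsolutelyContinuousOnInterval.totalLengthFilter ⊓
      𝓟 (AbsolutelyContinuousOnInterval.disjWithin a b),
      E ∈ AbsolutelyContinuousOnInterval.disjWithin a b :=
    mem_inf_of_right (mem_principal_self _)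
  filter_upwards [h1] with E hE
  rw [Finset.mul_sum]
  refine Finset.sum_le_sum fun i hi => ?_
  exact hK.dist_le_mul _ (by simpa using hC _ (hE.1 i hi).1) _ (by simpa using hC _ (hE.1 i hi).2)

theorem _root_.IntervalIntegrable.absolutelyContinuousOnInterval_integral {F : Type*}
    [NormedAddCommGroup F] [NormedSpace ℝ F] {f : ℝ → F} {a b : ℝ}
    (hf : IntervalIntegrable f volume a b) :
    AbsolutelyContinuousOnInterval (fun t => ∫ τ in a..t, f τ) a b := by
  refine squeeze_zero' (Eventually.of_forall fun E => Finset.sum_nonneg fun i _ => dist_nonneg) ?_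
    (hf.norm.absolutelyContinuousOnInterval_intervalIntegral (left_mem_uIcc))
  have h1 : ∀ᶠ E in AbsolutelyContinuousOnInterval.totalLengthFilter ⊓
      𝓟 (AbsolutelyContinuousOnInterval.disjWithin a b),
      E ∈ AbsolutelyContinuousOnInterval.disjWithin a b :=
    mem_inf_of_right (mem_principal_self _)
  filter_upwards [h1] with E hE
  refine Finset.sum_le_sum fun i hi => ?_
  have hi1 : ∀ {c}, c ∈ uIcc a b → IntervalIntegrable f volume a c := fun hc =>
    hf.mono_set (uIcc_subset_uIcc left_mem_uIcc hc)
  have m1 := (hE.1 i hi).1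
  have m2 := (hE.1 i hi).2
  rw [dist_eq_norm, dist_eq_norm, intervalIntegral.integral_interval_sub_left (hi1 m1) (hi1 m2),
    intervalIntegral.integral_interval_sub_left (hi1 m1).norm (hi1 m2).norm, Real.norm_eq_abs]
  exact intervalIntegral.norm_integral_le_abs_integral_norm

/-- The fundamental theorem of calculus for absolutely continuous vector-valued curves. -/
theorem _root_.AbsolutelyContinuousOnInterval.sub_eq_integral {F : Type*}
    [NormedAddCommGroup F] [NormedSpace ℝ F] [CompleteSpace F] {f f' : ℝ → F}
    (hf : AbsolutelyContinuousOnInterval f 0 1) (hf' : IntervalIntegrable f' volume 0 1)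
    (h : ∀ᵐ t ∂volume.restrict (Icc (0 : ℝ) 1), HasDerivAt f (f' t) t) {t : ℝ}
    (ht : t ∈ Icc (0 : ℝ) 1) : f t - f 0 = ∫ τ in (0 : ℝ)..t, f' τ := by
  have h01 : uIcc (0 : ℝ) 1 = Icc 0 1 := uIcc_of_le zero_le_one
  have h1 := hf.sub hf'.absolutelyContinuousOnInterval_integral
  obtain ⟨C, hC⟩ := h1.const_of_ae_hasDerivAt_zero (by
    rw [ae_restrict_iff' measurableSet_Icc] at h
    filter_upwards [h, hf'.ae_hasDerivAt_integral] with x hx hx' hmem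
    have := (hx (h01 ▸ hmem)).sub (hx' hmem 0 left_mem_uIcc)
    simpa using this)
  have h2 := hC t (h01 ▸ ht)
  have h3 := hC 0 left_mem_uIcc
  simp only [Pi.sub_apply, intervalIntegral.integral_same, sub_zero] at h2 h3
  rw [h3, ← h2]
  abel

end AbsolutelyContinuous

/-! ### Linear control systems and their Volterra operators -/

section Volterra

open Set

variable {n : ℕ} (B : EuclideanSpace ℝ (Fin 2) →L[ℝ] ((Fin n → ℝ) →L[ℝ] (Fin n → ℝ)))

theorem _root_.ContinuousMap.continuous_IccExtend_zero_one {E : Type*} [TopologicalSpace E]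
    (f : C(Icc (0 : ℝ) 1, E)) : Continuous (IccExtend zero_le_one f) :=
  f.continuous.Icc_extend'

theorem intervalIntegrable_control_norm (u : Control) : IntervalIntegrable (fun t => ‖u t‖) volume 0 1 := by
  rw [intervalIntegrable_iff_integrableOn_Icc_of_le zero_le_one]
  exact (L1.integrable_coeFn u).norm

theorem intervalIntegrable_control_apply (u : Control) {q : ℝ → Fin n → ℝ}
    (hq : ContinuousOn q (Icc 0 1)) :
    IntervalIntegrable (fun t => B (u t) (q t)) volume 0 1 := by
  rw [intervalIntegrable_iff_integrableOn_Icc_of_le zero_le_one]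
  obtain ⟨C, hC⟩ := isCompact_Icc.exists_bound_of_continuousOn hq
  have hu := L1.integrable_coeFn u
  refine Integrable.mono' (g := fun t => ‖B‖ * ‖u t‖ * C) ((hu.norm.const_mul _).mul_const _) ?_ ?_
  · exact isBoundedBilinearMap_apply.continuous.comp_aestronglyMeasurable
      ((B.continuous.comp_aestronglyMeasurable hu.aestronglyMeasurable).prodMk
        (hq.aestronglyMeasurable measurableSet_Icc))
  · filter_upwards [ae_restrict_mem measurableSet_Icc] with t ht
    refine ((B (u t)).le_opNorm _).trans ?_
    exact mul_le_mul (B.le_opNorm _) (hC t ht) (norm_nonneg _) (by positivity)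

theorem ae_restrict_uIoc_of_ae {P : ℝ → Prop} (h : ∀ᵐ t ∂volume.restrict (Icc (0 : ℝ) 1), P t) {t : ℝ}
    (ht : t ∈ Icc (0 : ℝ) 1) : ∀ᵐ τ ∂volume.restrict (uIoc 0 t), P τ := by
  refine ae_restrict_of_ae_restrict_of_subset ?_ h
  rw [uIoc_of_le ht.1]
  exact fun x hx => ⟨hx.1.le, hx.2.trans ht.2⟩

theorem _root_.IntervalIntegrable.mono_zero_one {F : Type*} [NormedAddCommGroup F] {f : ℝ → F}
    (hf : IntervalIntegrable f volume 0 1) {t : ℝ} (ht : t ∈ Icc (0 : ℝ) 1) :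
    IntervalIntegrable f volume 0 t := by
  refine hf.mono_set (uIcc_subset_uIcc left_mem_uIcc ?_)
  rwa [uIcc_of_le zero_le_one]

/-- The integral operator of the linear control system `q' = B(u) q`. -/
noncomputable def volterraFun (u : Control) (f : C(Icc (0 : ℝ) 1, Fin n → ℝ)) :
    C(Icc (0 : ℝ) 1, Fin n → ℝ) where
  toFun t := ∫ τ in (0 : ℝ)..t, B (u τ) (IccExtend zero_le_one f τ)
  continuous_toFun := by
    have h1 := (intervalIntegrable_control_apply B u
      f.continuous_IccExtend_zero_one.continuousOn).absolutelyContinuousOnInterval_integral.continuousOn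
    rw [uIcc_of_le zero_le_one] at h1
    exact continuousOn_iff_continuous_domRestrict.1 h1

theorem volterraFun_apply (u : Control) (f : C(Icc (0 : ℝ) 1, Fin n → ℝ)) (t : Icc (0 : ℝ) 1) :
    volterraFun B u f t = ∫ τ in (0 : ℝ)..t, B (u τ) (IccExtend zero_le_one f τ) := rfl

theorem volterraFun_norm_le (u : Control) (f : C(Icc (0 : ℝ) 1, Fin n → ℝ)) :
    ‖volterraFun B u f‖ ≤ ‖B‖ * ‖u‖ * ‖f‖ := by
  rw [ContinuousMap.norm_le _ (by positivity)]
  intro t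
  have hu := intervalIntegrable_control_norm u
  have hle : ∀ τ, ‖B (u τ) (IccExtend zero_le_one f τ)‖ ≤ ‖B‖ * ‖u τ‖ * ‖f‖ := fun τ =>
    ((B (u τ)).le_opNorm _).trans
      (mul_le_mul (B.le_opNorm _) (f.norm_coe_le_norm _) (norm_nonneg _) (by positivity))
  calc ‖∫ τ in (0 : ℝ)..t, B (u τ) (IccExtend zero_le_one f τ)‖
      ≤ ∫ τ in (0 : ℝ)..t, ‖B‖ * ‖u τ‖ * ‖f‖ :=
        intervalIntegral.norm_integral_le_of_norm_le t.2.1 (Filter.Eventually.of_forall fun τ _ => hle τ)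
          (((hu.const_mul _).mul_const _).mono_zero_one t.2)
    _ ≤ ∫ τ in (0 : ℝ)..1, ‖B‖ * ‖u τ‖ * ‖f‖ :=
        intervalIntegral.integral_mono_interval le_rfl t.2.1 t.2.2
          (Filter.Eventually.of_forall fun τ => by positivity) ((hu.const_mul _).mul_const _)
    _ = ‖B‖ * ‖u‖ * ‖f‖ := by
        rw [intervalIntegral.integral_mul_const, intervalIntegral.integral_const_mul,
          L1.norm_eq_integral_norm, intervalIntegral.integral_of_le zero_le_one,
          integral_Icc_eq_integral_Ioc]

noncomputable def volterra :
    Control →L[ℝ] (C(Icc (0 : ℝ) 1, Fin n → ℝ) →L[ℝ] C(Icc (0 : ℝ) 1, Fin n → ℝ)) :=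
  LinearMap.mkContinuous₂
    (LinearMap.mk₂ ℝ (volterraFun B)
      (fun u v f => by
        ext1 t
        have hu := intervalIntegrable_control_apply B u f.continuous_IccExtend_zero_one.continuousOn
        have hv := intervalIntegrable_control_apply B v f.continuous_IccExtend_zero_one.continuousOn
        simp only [volterraFun_apply, ContinuousMap.add_apply]
        rw [← intervalIntegral.integral_add (hu.mono_zero_one t.2) (hv.mono_zero_one t.2)]
        refine intervalIntegral.integral_congr_ae_restrict ?_
        filter_upwards [ae_restrict_uIoc_of_ae (Lp.coeFn_add u v) t.2] with τ hτ
        rw [hτ]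
        simp)
      (fun c u f => by
        ext1 t
        simp only [volterraFun_apply, ContinuousMap.smul_apply]
        rw [← intervalIntegral.integral_smul]
        refine intervalIntegral.integral_congr_ae_restrict ?_
        filter_upwards [ae_restrict_uIoc_of_ae (Lp.coeFn_smul c u) t.2] with τ hτ
        rw [hτ]
        simp)
      (fun u f g => by
        ext1 t
        have hf := intervalIntegrable_control_apply B u f.continuous_IccExtend_zero_one.continuousOn
        have hg := intervalIntegrable_control_apply B u g.continuous_IccExtend_zero_one.continuousOn
        simp only [volterraFun_apply, ContinuousMap.add_apply]
        rw [← intervalIntegral.integral_add (hf.mono_zero_one t.2) (hg.mono_zero_one t.2)]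
        simp [IccExtend])
      (fun c u f => by
        ext1 t
        simp only [volterraFun_apply, ContinuousMap.smul_apply]
        rw [← intervalIntegral.integral_smul]
        simp [IccExtend]))
    ‖B‖ (fun u f => volterraFun_norm_le B u f)

theorem volterra_apply (u : Control) (f : C(Icc (0 : ℝ) 1, Fin n → ℝ)) (t : Icc (0 : ℝ) 1) :
    volterra B u f t = ∫ τ in (0 : ℝ)..t, B (u τ) (IccExtend zero_le_one f τ) := rfl

variable {B}

/-- Each application of a strictly triangular integral operator annihilates one more leading
component. Nilpotency then inverts 1 - V for every control, with no smallness assumption. -/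
theorem volterra_pow_apply_eq_zero
    (hB : ∀ v f (m : Fin n), (∀ k < m, f k = 0) → B v f m = 0) (u : Control)
    (f : C(Icc (0 : ℝ) 1, Fin n → ℝ)) (j : ℕ) (t : Icc (0 : ℝ) 1) (m : Fin n) (hm : (m : ℕ) < j) :
    ((volterra B u) ^ j) f t m = 0 := by
  induction j generalizing t m with
  | zero => omega
  | succ j ih =>
    rw [pow_succ', mul_apply_eq_comp, volterra_apply]
    have h1 := (intervalIntegrable_control_apply B u
      (((volterra B u) ^ j) f).continuous_IccExtend_zero_one.continuousOn).mono_zero_one t.2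
    have h2 := (ContinuousLinearMap.proj (R := ℝ) (φ := fun _ : Fin n => ℝ) m).intervalIntegral_comp_comm h1
    simp only [ContinuousLinearMap.proj_apply] at h2
    rw [← h2]
    refine intervalIntegral.integral_zero_ae (Filter.Eventually.of_forall fun τ _ => ?_)
    exact hB _ _ _ fun k hk => ih _ k (by
      have : (k : ℕ) < m := hk
      omega)

theorem isUnit_one_sub_volterra (hB : ∀ v f (m : Fin n), (∀ k < m, f k = 0) → B v f m = 0)
    (u : Control) : IsUnit (1 - volterra B u) := by
  refine IsNilpotent.isUnit_one_sub ⟨n, ?_⟩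
  ext f t m
  exact volterra_pow_apply_eq_zero hB u f n t m m.2

variable (B) in
/-- The solution of `q' = B(u) q`, `q(0) = q₀`. -/
noncomputable def linSol (q₀ : Fin n → ℝ) (u : Control) : C(Icc (0 : ℝ) 1, Fin n → ℝ) :=
  Ring.inverse (1 - volterra B u) (ContinuousMap.const _ q₀)

theorem linSol_eq (hB : ∀ v f (m : Fin n), (∀ k < m, f k = 0) → B v f m = 0) (q₀ : Fin n → ℝ)
    (u : Control) :
    linSol B q₀ u = ContinuousMap.const _ q₀ + volterra B u (linSol B q₀ u) := by
  have h1 := Ring.mul_inverse_cancel _ (isUnit_one_sub_volterra hB u)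
  have h2 := congrArg (fun A => A (ContinuousMap.const _ q₀)) h1
  simp only [mul_apply_eq_comp, sub_apply, one_apply_eq_self] at h2
  exact sub_eq_iff_eq_add.1 h2

theorem eq_linSol (hB : ∀ v f (m : Fin n), (∀ k < m, f k = 0) → B v f m = 0) (q₀ : Fin n → ℝ)
    (u : Control) (f : C(Icc (0 : ℝ) 1, Fin n → ℝ))
    (hf : f = ContinuousMap.const _ q₀ + volterra B u f) : f = linSol B q₀ u := by
  have h1 := Ring.inverse_mul_cancel _ (isUnit_one_sub_volterra hB u)
  have h2 : (1 - volterra B u) f = ContinuousMap.const _ q₀ := sub_eq_iff_eq_add.2 hf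
  rw [linSol, ← h2]
  exact (congrArg (fun A => A f) h1).symm

theorem differentiable_linSol (hB : ∀ v f (m : Fin n), (∀ k < m, f k = 0) → B v f m = 0)
    (q₀ : Fin n → ℝ) : Differentiable ℝ (linSol B q₀) := by
  intro u
  have h0 := differentiableAt_inverse (𝕜 := ℝ)
    (R := C(Icc (0 : ℝ) 1, Fin n → ℝ) →L[ℝ] C(Icc (0 : ℝ) 1, Fin n → ℝ)) (isUnit_one_sub_volterra hB u)
  have h1 : DifferentiableAt ℝ (fun u => Ring.inverse (1 - volterra B u)) u :=
    DifferentiableAt.comp (𝕜 := ℝ) (g := Ring.inverse) (f := fun u => 1 - volterra B u) u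
      h0
      ((differentiableAt_const _).sub (volterra B).differentiableAt)
  exact h1.clm_apply (differentiableAt_const _)

/-- The linearised equation comes from differentiating the fixed-point equation itself, which is
bilinear in control and solution; the derivative of operator inversion is never computed. -/
theorem fderiv_linSol_eq (hB : ∀ v f (m : Fin n), (∀ k < m, f k = 0) → B v f m = 0)
    (q₀ : Fin n → ℝ) (u v : Control) :
    fderiv ℝ (linSol B q₀) u v
      = volterra B v (linSol B q₀ u) + volterra B u (fderiv ℝ (linSol B q₀) u v) := by
  have h1 := (differentiable_linSol hB q₀ u).hasFDerivAt
  have h2 : HasFDerivAt (linSol B q₀) _ u :=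
    (((volterra B).hasFDerivAt (x := u)).clm_apply h1 |>.const_add
      (ContinuousMap.const _ q₀)).congr_of_eventuallyEq
      (Filter.Eventually.of_forall fun u => linSol_eq hB q₀ u)
  have h3 := congrArg (fun A => A v) (h1.unique h2)
  simp only [add_apply, ContinuousLinearMap.comp_apply,
    ContinuousLinearMap.flip_apply] at h3
  rw [add_comm]
  exact h3

/-- An absolutely continuous solution is given by the resolvent of the integral operator. -/
theorem eq_linSol_of_hasDerivAt (hB : ∀ v f (m : Fin n), (∀ k < m, f k = 0) → B v f m = 0)
    (u : Control) {q : ℝ → Fin n → ℝ} (hq : AbsolutelyContinuousOnInterval q 0 1)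
    (h : ∀ᵐ t ∂volume.restrict (Icc (0 : ℝ) 1), HasDerivAt q (B (u t) (q t)) t)
    (t : Icc (0 : ℝ) 1) : q t = linSol B (q 0) u t := by
  have hc : ContinuousOn q (Icc 0 1) := by
    have := hq.continuousOn
    rwa [uIcc_of_le zero_le_one] at this
  set f : C(Icc (0 : ℝ) 1, Fin n → ℝ) := ⟨(Icc (0 : ℝ) 1).domRestrict q, hc.domRestrict⟩ with hf
  have h1 : f = linSol B (q 0) u := by
    refine eq_linSol hB _ u f (ContinuousMap.ext fun t => ?_)
    have h2 := hq.sub_eq_integral (intervalIntegrable_control_apply B u hc) h t.2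
    rw [sub_eq_iff_eq_add'] at h2
    rw [ContinuousMap.add_apply, volterra_apply, ContinuousMap.const_apply]
    refine h2.trans ?_
    congr 1
    refine intervalIntegral.integral_congr fun τ hτ => ?_
    rw [uIcc_of_le t.2.1] at hτ
    have : IccExtend zero_le_one f τ = q τ :=
      IccExtend_of_mem zero_le_one f ⟨hτ.1, hτ.2.trans t.2.2⟩
    simp only [this]
  rw [← h1]
  rfl

end Volterra

end Carnot

/-! ### Horizontal curves and the endpoint map in the model -/

namespace Carnot

open Set

variable {𝔤 : Type*} [LieRing 𝔤] [LieAlgebra ℝ 𝔤]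

/-- The linear control system satisfied by the model coordinates of a horizontal curve. -/
noncomputable def modelControl (s : ℕ) (X : Module.Basis (Fin (s + 1)) ℝ 𝔤) :
    EuclideanSpace ℝ (Fin 2) →L[ℝ] ((Fin (s + 2) → ℝ) →L[ℝ] (Fin (s + 2) → ℝ)) :=
  LinearMap.toContinuousLinearMap
    (-(repL s X ∘ₗ ((LinearMap.toSpanSingleton ℝ 𝔤 (X 0)) ∘ₗ
          (EuclideanSpace.proj (𝕜 := ℝ) (0 : Fin 2)).toLinearMap
        + (LinearMap.toSpanSingleton ℝ 𝔤 (X 1)) ∘ₗ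
          (EuclideanSpace.proj (𝕜 := ℝ) (1 : Fin 2)).toLinearMap)))

theorem modelControl_apply (s : ℕ) (X : Module.Basis (Fin (s + 1)) ℝ 𝔤)
    (v : EuclideanSpace ℝ (Fin 2)) :
    modelControl s X v = -repL s X (v 0 • X 0 + v 1 • X 1) := rfl

theorem fin_val_one {s : ℕ} (hs : 5 ≤ s) : ((1 : Fin (s + 1)) : ℕ) = 1 := by
  rw [Fin.val_one']
  exact Nat.mod_eq_of_lt (by omega)

theorem equivFun_symm_horizontalVector {s : ℕ} (hs : 5 ≤ s) (X : Module.Basis (Fin (s + 1)) ℝ 𝔤)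
    (v : EuclideanSpace ℝ (Fin 2)) :
    X.equivFun.symm (horizontalVector (s + 1) v) = v 0 • X 0 + v 1 • X 1 := by
  have h1 := fin_val_one hs
  have h01 : (0 : Fin (s + 1)) ≠ 1 := fun h => by
    have := congrArg Fin.val h
    rw [h1] at this
    simp at this
  rw [Module.Basis.equivFun_symm_apply, Fintype.sum_eq_add 0 1 h01]
  · have h2 : s ≠ 0 := by omega
    simp [horizontalVector, h2, Nat.pos_of_ne_zero h2]
  · rintro i ⟨hi0, hi1⟩
    have h2 : (i : ℕ) ≠ 0 := fun h => hi0 (Fin.ext h)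
    have h3 : (i : ℕ) ≠ 1 := fun h => hi1 (Fin.ext (h.trans h1.symm))
    simp [horizontalVector, h2, h3]

theorem modelControl_strictly_triangular (s : ℕ) (X : Module.Basis (Fin (s + 1)) ℝ 𝔤)
    (v : EuclideanSpace ℝ (Fin 2)) (f : Fin (s + 2) → ℝ) (m : Fin (s + 2)) (h : ∀ k < m, f k = 0) :
    modelControl s X v f m = 0 := by
  have h1 : ∀ i, modelOp s i f m = 0 := by
    intro i
    induction m using Fin.cases with
    | zero => exact modelOp_apply_zero i f
    | succ m =>
      rw [modelOp_apply_succ_congr m i f 0, map_zero, Pi.zero_apply]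
      intro k hk
      exact h k (Fin.lt_def.2 (by simp; omega))
  rw [modelControl_apply, neg_apply, Pi.neg_apply, repL_apply, map_add, map_smul, map_smul,
    rep_basis, rep_basis]
  simp [h1]

theorem IsHorizontalCurve.hasDerivAt_frame {s : ℕ} (hs : 5 ≤ s)
    {X : Module.Basis (Fin (s + 1)) ℝ 𝔤} (hX : IsTypeIIFiliform s X)
    {u : Control} {γ : ℝ → Fin (s + 1) → ℝ} (hγ : IsHorizontalCurve s X u γ) :
    ∀ᵐ t ∂volume.restrict (Icc (0 : ℝ) 1), HasDerivAt (fun t => frame s X (γ t))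
      (modelControl s X (u t) * frame s X (γ t)) t := by
  filter_upwards [hγ.2.2] with t ht
  have h1 := (((contDiff_frame s X).differentiable one_ne_zero (γ t)).hasFDerivAt).comp_hasDerivAt t ht
  rwa [hX.fderiv_frame_leftTranslationDeriv hs, equivFun_symm_horizontalVector hs] at h1

theorem frame_zero (s : ℕ) (X : Module.Basis (Fin (s + 1)) ℝ 𝔤) : frame s X 0 = 1 := by
  simp [frame]

theorem IsHorizontalCurve.frame_apply_eq_linSol {s : ℕ} (hs : 5 ≤ s)
    {X : Module.Basis (Fin (s + 1)) ℝ 𝔤} (hX : IsTypeIIFiliform s X)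
    {u : Control} {γ : ℝ → Fin (s + 1) → ℝ} (hγ : IsHorizontalCurve s X u γ) (t : Icc (0 : ℝ) 1) :
    frame s X (γ t) (Pi.single 0 1) = linSol (modelControl s X) (Pi.single 0 1) u t := by
  have h1 := eq_linSol_of_hasDerivAt (modelControl_strictly_triangular s X) u
    (q := fun t => frame s X (γ t) (Pi.single 0 1))
    (hγ.1.contDiff_comp (g := fun p => frame s X p (Pi.single 0 1))
      ((contDiff_frame s X).clm_apply contDiff_const))
    (by
      filter_upwards [hγ.hasDerivAt_frame hs hX] with t ht
      simpa using ht.clm_apply (hasDerivAt_const t (Pi.single (0 : Fin (s + 2)) (1 : ℝ)))) t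
  simpa [hγ.2.1, frame_zero] using h1

theorem IsHorizontalCurve.modelCoord_eq {s : ℕ} (hs : 5 ≤ s)
    {X : Module.Basis (Fin (s + 1)) ℝ 𝔤} (hX : IsTypeIIFiliform s X)
    {u : Control} {γ : ℝ → Fin (s + 1) → ℝ} (hγ : IsHorizontalCurve s X u γ) (t : Icc (0 : ℝ) 1) :
    modelCoord s X (γ t)
      = fun i => linSol (modelControl s X) (Pi.single 0 1) u t (Fin.succ i) := by
  rw [← hγ.frame_apply_eq_linSol hs hX t]
  rfl

theorem IsHorizontalCurve.eqOn {s : ℕ} (hs : 5 ≤ s)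
    {X : Module.Basis (Fin (s + 1)) ℝ 𝔤} (hX : IsTypeIIFiliform s X)
    {u : Control} {γ γ' : ℝ → Fin (s + 1) → ℝ} (hγ : IsHorizontalCurve s X u γ)
    (hγ' : IsHorizontalCurve s X u γ') : EqOn γ γ' (Icc 0 1) := by
  obtain ⟨g, -, -, hg⟩ := exists_contDiff_inverse_modelCoord s X
  intro t ht
  rw [← hg (γ t), ← hg (γ' t), hγ.modelCoord_eq hs hX ⟨t, ht⟩, hγ'.modelCoord_eq hs hX ⟨t, ht⟩]

section LinearCurve

variable {n : ℕ} (B : EuclideanSpace ℝ (Fin 2) →L[ℝ] ((Fin n → ℝ) →L[ℝ] (Fin n → ℝ)))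

/-- The solution of `q' = B(u) q`, `q(0) = q₀`, as a curve on the real line. -/
noncomputable def linCurve (q₀ : Fin n → ℝ) (u : Control) (t : ℝ) : Fin n → ℝ :=
  q₀ + ∫ τ in (0 : ℝ)..t, B (u τ) (IccExtend zero_le_one (linSol B q₀ u) τ)

theorem intervalIntegrable_linSol (q₀ : Fin n → ℝ) (u : Control) :
    IntervalIntegrable (fun τ => B (u τ) (IccExtend zero_le_one (linSol B q₀ u) τ)) volume 0 1 :=
  intervalIntegrable_control_apply B u (linSol B q₀ u).continuous_IccExtend_zero_one.continuousOn

theorem absolutelyContinuous_linCurve (q₀ : Fin n → ℝ) (u : Control) :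
    AbsolutelyContinuousOnInterval (linCurve B q₀ u) 0 1 :=
  (intervalIntegrable_linSol B q₀ u).absolutelyContinuousOnInterval_integral.contDiff_comp
    (g := fun y => q₀ + y) (contDiff_const.add contDiff_id)

variable {B}

theorem linCurve_eq (hB : ∀ v f (m : Fin n), (∀ k < m, f k = 0) → B v f m = 0)
    (q₀ : Fin n → ℝ) (u : Control) {t : ℝ} (ht : t ∈ Icc (0 : ℝ) 1) :
    linCurve B q₀ u t = IccExtend zero_le_one (linSol B q₀ u) t := by
  have h1 := congrArg (fun f => f ⟨t, ht⟩) (linSol_eq hB q₀ u)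
  rw [IccExtend_of_mem _ _ ht]
  exact h1.symm

theorem hasDerivAt_linCurve (hB : ∀ v f (m : Fin n), (∀ k < m, f k = 0) → B v f m = 0)
    (q₀ : Fin n → ℝ) (u : Control) :
    ∀ᵐ t ∂volume.restrict (Icc (0 : ℝ) 1),
      HasDerivAt (linCurve B q₀ u) (B (u t) (linCurve B q₀ u t)) t := by
  rw [ae_restrict_iff' measurableSet_Icc]
  filter_upwards [(intervalIntegrable_linSol B q₀ u).ae_hasDerivAt_integral] with t ht hmem
  rw [linCurve_eq hB q₀ u hmem]
  exact (ht (by rwa [uIcc_of_le zero_le_one]) 0 left_mem_uIcc).const_add q₀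

theorem linCurve_apply_of_forall_eq_zero {m : Fin n} (hm : ∀ v w, B v w m = 0)
    (q₀ : Fin n → ℝ) (u : Control) {t : ℝ} (ht : t ∈ Icc (0 : ℝ) 1) :
    linCurve B q₀ u t m = q₀ m := by
  have h1 := (ContinuousLinearMap.proj (R := ℝ) (φ := fun _ : Fin n => ℝ)
    m).intervalIntegral_comp_comm ((intervalIntegrable_linSol B q₀ u).mono_zero_one ht)
  simp only [ContinuousLinearMap.proj_apply, hm, intervalIntegral.integral_zero] at h1
  rw [linCurve, Pi.add_apply, ← h1, add_zero]

end LinearCurve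

/-- Forgetting the constant coordinate of a state. -/
noncomputable def tailL (s : ℕ) : (Fin (s + 2) → ℝ) →L[ℝ] (Fin (s + 1) → ℝ) :=
  ContinuousLinearMap.pi fun i => ContinuousLinearMap.proj (Fin.succ i)

theorem tailL_apply (s : ℕ) (f : Fin (s + 2) → ℝ) (i : Fin (s + 1)) : tailL s f i = f i.succ := rfl

theorem modelCoord_eq_tailL (s : ℕ) (X : Module.Basis (Fin (s + 1)) ℝ 𝔤) (p : Fin (s + 1) → ℝ) :
    modelCoord s X p = tailL s (frame s X p (Pi.single 0 1)) := rfl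

theorem fderiv_modelCoord_leftTranslationDeriv {s : ℕ} (hs : 5 ≤ s)
    {X : Module.Basis (Fin (s + 1)) ℝ 𝔤} (hX : IsTypeIIFiliform s X) (p : Fin (s + 1) → ℝ)
    (v : EuclideanSpace ℝ (Fin 2)) :
    fderiv ℝ (modelCoord s X) p (leftTranslationDeriv s X p (horizontalVector (s + 1) v))
      = tailL s (modelControl s X v (frame s X p (Pi.single 0 1))) := by
  have h1 := ((contDiff_frame s X).differentiable one_ne_zero p).hasFDerivAt.clm_apply
    (hasFDerivAt_const (Pi.single (0 : Fin (s + 2)) (1 : ℝ)) p)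
  have h2 : HasFDerivAt (modelCoord s X) _ p := (tailL s).hasFDerivAt.comp p h1
  rw [h2.fderiv, modelControl_apply, ← equivFun_symm_horizontalVector hs,
    ContinuousLinearMap.comp_apply, add_apply, ContinuousLinearMap.comp_apply,
    ContinuousLinearMap.flip_apply, hX.fderiv_frame_leftTranslationDeriv hs]
  simp

theorem fderiv_comp_fderiv_of_leftInverse {E F : Type*} [NormedAddCommGroup E] [NormedSpace ℝ E]
    [NormedAddCommGroup F] [NormedSpace ℝ F] {f : E → F} {g : F → E} (hf : Differentiable ℝ f)
    (hg : Differentiable ℝ g) (h : ∀ x, g (f x) = x) (x v : E) :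
    fderiv ℝ g (f x) (fderiv ℝ f x v) = v := by
  have h1 := (hg (f x)).hasFDerivAt.comp x (hf x).hasFDerivAt
  rw [show g ∘ f = id from funext h] at h1
  exact congrArg (fun A => A v) (h1.unique (hasFDerivAt_id x))

/-- The model velocity is the image of the horizontal velocity under the differential of
`modelCoord`, which the differential of `g` undoes. The condition on entry 0 places the state on the
orbit of e₀. -/
theorem hasDerivAt_of_hasDerivAt_model {s : ℕ} (hs : 5 ≤ s)
    {X : Module.Basis (Fin (s + 1)) ℝ 𝔤} (hX : IsTypeIIFiliform s X)
    {g : (Fin (s + 1) → ℝ) → (Fin (s + 1) → ℝ)} (hg : Differentiable ℝ g)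
    (hgr : ∀ y, modelCoord s X (g y) = y) (hgl : ∀ p, g (modelCoord s X p) = p)
    {q : ℝ → Fin (s + 2) → ℝ} {t : ℝ} {v : EuclideanSpace ℝ (Fin 2)} (h0 : q t 0 = 1)
    (h : HasDerivAt q (modelControl s X v (q t)) t) :
    HasDerivAt (fun t => g (tailL s (q t)))
      (leftTranslationDeriv s X (g (tailL s (q t))) (horizontalVector (s + 1) v)) t := by
  have hframe : frame s X (g (tailL s (q t))) (Pi.single 0 1) = q t := by
    rw [frame_apply_single, hgr]
    funext k
    induction k using Fin.cases with
    | zero => exact h0.symm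
    | succ k => rw [Fin.cons_succ, tailL_apply]
  have h1 : HasDerivAt (fun t => tailL s (q t)) (tailL s (modelControl s X v (q t))) t :=
    (tailL s).hasFDerivAt.comp_hasDerivAt t h
  have hd : HasDerivAt (fun t => g (tailL s (q t))) _ t :=
    (hg (tailL s (q t))).hasFDerivAt.comp_hasDerivAt t h1
  have h4 := fderiv_comp_fderiv_of_leftInverse ((contDiff_modelCoord s X).differentiable one_ne_zero)
    hg hgl (g (tailL s (q t)))
    (leftTranslationDeriv s X (g (tailL s (q t))) (horizontalVector (s + 1) v))
  rw [fderiv_modelCoord_leftTranslationDeriv hs hX, hframe, hgr] at h4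
  rwa [h4] at hd

theorem exists_isHorizontalCurve {s : ℕ} (hs : 5 ≤ s)
    {X : Module.Basis (Fin (s + 1)) ℝ 𝔤} (hX : IsTypeIIFiliform s X) (u : Control) :
    ∃ γ, IsHorizontalCurve s X u γ := by
  obtain ⟨g, hgc, hgr, hgl⟩ := exists_contDiff_inverse_modelCoord s X
  have hB := modelControl_strictly_triangular s X
  have hq := absolutelyContinuous_linCurve (modelControl s X) (Pi.single 0 1) u
  have hq' := hasDerivAt_linCurve hB (Pi.single 0 1) u
  have hq1 : linCurve (modelControl s X) (Pi.single 0 1) u 0 = Pi.single 0 1 := by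
    rw [linCurve, intervalIntegral.integral_same, add_zero]
  -- Entry 0 has no predecessors, so strict triangularity forces its velocity to vanish.
  have h0 : ∀ t ∈ Icc (0 : ℝ) 1, linCurve (modelControl s X) (Pi.single 0 1) u t 0 = 1 := by
    intro t ht
    rw [linCurve_apply_of_forall_eq_zero (fun v w => hB v w 0 fun k hk =>
      absurd hk (Fin.not_lt_zero k)) _ u ht, Pi.single_eq_same]
  generalize linCurve (modelControl s X) (Pi.single 0 1) u = q at hq hq' hq1 h0
  refine ⟨fun t => g (tailL s (q t)), ?_⟩
  refine ⟨hq.contDiff_comp (g := fun y => g (tailL s y)) (hgc.comp (tailL s).contDiff), ?_, ?_⟩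
  · have h1 : tailL s (q 0) = modelCoord s X 0 := by
      rw [modelCoord_eq_tailL, frame_zero, hq1, one_apply_eq_self]
    simp only [h1, hgl]
  · filter_upwards [hq', ae_restrict_mem measurableSet_Icc] with t ht hmem
    exact hasDerivAt_of_hasDerivAt_model hs hX (hgc.differentiable one_ne_zero) hgr hgl (h0 t hmem) ht

/-- The endpoint of the model trajectory. -/
noncomputable def modelEndpoint (s : ℕ) (X : Module.Basis (Fin (s + 1)) ℝ 𝔤) (u : Control) :
    Fin (s + 1) → ℝ :=
  fun i => linSol (modelControl s X) (Pi.single 0 1) u 1 (Fin.succ i)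

theorem modelCoord_endpointMap {s : ℕ} (hs : 5 ≤ s)
    {X : Module.Basis (Fin (s + 1)) ℝ 𝔤} (hX : IsTypeIIFiliform s X) (u : Control) :
    modelCoord s X (endpointMap s X u) = modelEndpoint s X u := by
  have h := exists_isHorizontalCurve hs hX u
  rw [endpointMap, dif_pos h]
  exact h.choose_spec.modelCoord_eq hs hX 1

theorem hasFDerivAt_modelEndpoint (s : ℕ) (X : Module.Basis (Fin (s + 1)) ℝ 𝔤) (u : Control) :
    HasFDerivAt (modelEndpoint s X)
      (ContinuousLinearMap.pi fun i => (ContinuousLinearMap.proj (Fin.succ i)).comp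
        ((ContinuousMap.evalCLM ℝ (1 : Icc (0 : ℝ) 1)).comp
          (fderiv ℝ (linSol (modelControl s X) (Pi.single 0 1)) u))) u := by
  have h1 := (differentiable_linSol (modelControl_strictly_triangular s X)
    (Pi.single 0 1) u).hasFDerivAt
  rw [hasFDerivAt_pi]
  intro i
  exact ((ContinuousLinearMap.proj (R := ℝ) (φ := fun _ : Fin (s + 2) => ℝ) (Fin.succ i)).comp
    (ContinuousMap.evalCLM ℝ (1 : Icc (0 : ℝ) 1))).hasFDerivAt.comp u h1

theorem differentiable_endpointMap {s : ℕ} (hs : 5 ≤ s)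
    {X : Module.Basis (Fin (s + 1)) ℝ 𝔤} (hX : IsTypeIIFiliform s X) :
    Differentiable ℝ (endpointMap s X) := by
  obtain ⟨g, hgc, -, hgl⟩ := exists_contDiff_inverse_modelCoord s X
  have h1 : endpointMap s X = g ∘ modelEndpoint s X := by
    funext u
    rw [Function.comp, ← modelCoord_endpointMap hs hX, hgl]
  rw [h1]
  exact (hgc.differentiable one_ne_zero).comp
    fun u => (hasFDerivAt_modelEndpoint s X u).differentiableAt

/-- The two endpoint maps differ by a diffeomorphism. The left inverse makes its differential
injective, hence bijective in equal finite dimensions. -/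
theorem surjective_fderiv_endpointMap_iff {s : ℕ} (hs : 5 ≤ s)
    {X : Module.Basis (Fin (s + 1)) ℝ 𝔤} (hX : IsTypeIIFiliform s X) (u : Control) :
    Function.Surjective (fderiv ℝ (endpointMap s X) u) ↔
      Function.Surjective (fderiv ℝ (modelEndpoint s X) u) := by
  obtain ⟨g, hgc, -, hgl⟩ := exists_contDiff_inverse_modelCoord s X
  have hF := (differentiable_endpointMap hs hX u).hasFDerivAt
  have hE := (hasFDerivAt_modelEndpoint s X u).differentiableAt.hasFDerivAt
  have hΨ := ((contDiff_modelCoord s X).differentiable one_ne_zero (endpointMap s X u)).hasFDerivAt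
  have h1 : modelCoord s X ∘ endpointMap s X = modelEndpoint s X :=
    funext (modelCoord_endpointMap hs hX)
  have h3 := (h1 ▸ hΨ.comp u hF : HasFDerivAt (modelEndpoint s X) _ u).unique hE
  have h6 : Function.Injective (fderiv ℝ (modelCoord s X) (endpointMap s X u)) :=
    Function.LeftInverse.injective (fderiv_comp_fderiv_of_leftInverse
      ((contDiff_modelCoord s X).differentiable one_ne_zero) (hgc.differentiable one_ne_zero) hgl _)
  have h7 : Function.Surjective (fderiv ℝ (modelCoord s X) (endpointMap s X u)) :=
    (LinearMap.injective_iff_surjective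
      (f := (fderiv ℝ (modelCoord s X) (endpointMap s X u)).toLinearMap)).1 h6
  rw [← h3, ContinuousLinearMap.coe_comp]
  exact ⟨fun h => h7.comp h, fun h => h.of_comp_left h6⟩

end Carnot

/-! ### The covector equations -/

namespace Carnot

open Set Filter Topology

theorem _root_.AbsolutelyContinuousOnInterval.prodMk {E F : Type*} [PseudoMetricSpace E]
    [PseudoMetricSpace F] {f : ℝ → E} {g : ℝ → F} {a b : ℝ}
    (hf : AbsolutelyContinuousOnInterval f a b) (hg : AbsolutelyContinuousOnInterval g a b) :
    AbsolutelyContinuousOnInterval (fun t => (f t, g t)) a b := by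
  refine squeeze_zero (fun E => Finset.sum_nonneg fun i _ => dist_nonneg) (fun E => ?_)
    (by simpa using Tendsto.add hf hg)
  rw [← Finset.sum_add_distrib]
  refine Finset.sum_le_sum fun i _ => ?_
  rw [Prod.dist_eq]
  exact max_le_add_of_nonneg dist_nonneg dist_nonneg

/-- A zero with nonzero derivative is isolated among the zeros, so these points form a discrete
subspace of the line, which is Lindelöf and hence countable. -/
theorem countable_setOf_zero_of_deriv_ne_zero (f : ℝ → ℝ) :
    {t | f t = 0 ∧ ∃ d, d ≠ 0 ∧ HasDerivAt f d t}.Countable := by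
  set N := {t | f t = 0 ∧ ∃ d, d ≠ 0 ∧ HasDerivAt f d t} with hN
  have h1 : DiscreteTopology N := by
    rw [discreteTopology_subtype_iff]
    rintro t ⟨-, d, hd, hfd⟩
    rw [← disjoint_iff, disjoint_principal_right]
    filter_upwards [hfd.eventually_ne hd (c := 0)] with z hz hzN
    exact hz hzN.1
  have : Countable N := countable_of_Lindelof_of_discrete
  exact this

/-- At almost every zero of a function, its derivative vanishes. -/
theorem ae_eq_zero_of_hasDerivAt_of_eq_zero {f f' : ℝ → ℝ} {ν : Measure ℝ} [NullSingletonClass ν]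
    (h : ∀ᵐ t ∂ν, HasDerivAt f (f' t) t) : ∀ᵐ t ∂ν, f t = 0 → f' t = 0 := by
  have h1 := (countable_setOf_zero_of_deriv_ne_zero f).ae_notMem ν
  filter_upwards [h, h1] with t ht hN h0
  by_contra hd
  exact hN ⟨h0, _, hd, ht⟩

theorem _root_.AbsolutelyContinuousOnInterval.eq_of_ae_hasDerivAt_zero {f f' : ℝ → ℝ}
    (hf : AbsolutelyContinuousOnInterval f 0 1)
    (h : ∀ᵐ t ∂volume.restrict (Icc (0 : ℝ) 1), HasDerivAt f (f' t) t)
    (h0 : ∀ᵐ t ∂volume.restrict (Icc (0 : ℝ) 1), f' t = 0) {t₁ t₂ : ℝ}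
    (h1 : t₁ ∈ Icc (0 : ℝ) 1) (h2 : t₂ ∈ Icc (0 : ℝ) 1) : f t₁ = f t₂ := by
  rw [← uIcc_of_le zero_le_one] at h1 h2
  obtain ⟨C, hC⟩ := hf.const_of_ae_hasDerivAt_zero (by
    rw [ae_restrict_iff' measurableSet_Icc] at h h0
    filter_upwards [h, h0] with x hx hx0 hmem
    rw [uIcc_of_le zero_le_one] at hmem
    rw [← hx0 hmem]
    exact hx hmem)
  rw [hC _ h1, hC _ h2]

/-- The system of linear equations satisfied by the components of a covector along a horizontal
curve of the type II filiform group. -/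
structure IsCovectorSystem (s : ℕ) (w₀ w₁ : ℝ → ℝ) (a : ℕ → ℝ → ℝ) : Prop where
  absolutelyContinuous : ∀ i ≤ s, AbsolutelyContinuousOnInterval (a i) 0 1
  deriv_zero : ∀ᵐ t ∂volume.restrict (Icc (0 : ℝ) 1), HasDerivAt (a 0) (-(w₁ t * a 2 t)) t
  deriv_mid : ∀ i, 1 ≤ i → i + 2 ≤ s →
    ∀ᵐ t ∂volume.restrict (Icc (0 : ℝ) 1), HasDerivAt (a i) (w₀ t * a (i + 1) t) t
  deriv_penultimate : ∀ᵐ t ∂volume.restrict (Icc (0 : ℝ) 1), HasDerivAt (a (s - 1)) (w₁ t * a s t) t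
  deriv_last : ∀ᵐ t ∂volume.restrict (Icc (0 : ℝ) 1), HasDerivAt (a s) 0 t

namespace IsCovectorSystem

variable {s : ℕ} {w₀ w₁ : ℝ → ℝ} {a : ℕ → ℝ → ℝ}

theorem last_eq (h : IsCovectorSystem s w₀ w₁ a) {t : ℝ} (ht : t ∈ Icc (0 : ℝ) 1) : a s t = a s 0 :=
  (h.absolutelyContinuous s le_rfl).eq_of_ae_hasDerivAt_zero (f' := fun _ => 0) h.deriv_last
    (Eventually.of_forall fun _ => rfl) ht ⟨le_rfl, zero_le_one⟩

theorem penultimate_eq (h : IsCovectorSystem s w₀ w₁ a) (hw₁ : IntervalIntegrable w₁ volume 0 1)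
    {t : ℝ} (ht : t ∈ Icc (0 : ℝ) 1) :
    a (s - 1) t = a (s - 1) 0 + a s 0 * ∫ τ in (0 : ℝ)..t, w₁ τ := by
  have h1 : ∀ᵐ t ∂volume.restrict (Icc (0 : ℝ) 1), HasDerivAt (a (s - 1)) (a s 0 * w₁ t) t := by
    filter_upwards [h.deriv_penultimate, ae_restrict_mem measurableSet_Icc] with t h1 h2
    rwa [h.last_eq h2, mul_comm] at h1
  have h2 := (h.absolutelyContinuous (s - 1) (Nat.sub_le _ _)).sub_eq_integral (hw₁.const_mul _) h1 ht
  rw [intervalIntegral.integral_const_mul] at h2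
  linarith

/-- If every component but the first two vanishes from some index on, so do the ones before. -/
theorem eq_zero_of_le (h : IsCovectorSystem s w₀ w₁ a) {m : ℕ} (hm : m + 2 ≤ s)
    (hstep : ∀ᵐ t ∂volume.restrict (Icc (0 : ℝ) 1), w₀ t * a (m + 1) t = 0) {t₀ : ℝ}
    (ht₀ : t₀ ∈ Icc (0 : ℝ) 1) (h0 : ∀ i, 1 ≤ i → i ≤ m → a i t₀ = 0) {i : ℕ} (hi : 1 ≤ i)
    (him : i ≤ m) : ∀ t ∈ Icc (0 : ℝ) 1, a i t = 0 := by
  obtain ⟨k, rfl⟩ := Nat.exists_eq_add_of_le him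
  induction k generalizing i with
  | zero =>
    intro t ht
    rw [(h.absolutelyContinuous i (by omega)).eq_of_ae_hasDerivAt_zero (h.deriv_mid i hi (by omega))
      hstep ht ht₀]
    exact h0 i hi him
  | succ k ih =>
    intro t ht
    -- Descending induction: once component `i + 1` vanishes identically, component `i` has zero
    -- derivative and keeps its value at `t₀`.
    have hk : i + (k + 1) = i + 1 + k := by ring
    rw [hk] at hstep h0
    have h1 : ∀ t ∈ Icc (0 : ℝ) 1, a (i + 1) t = 0 :=
      ih (by omega) (by omega) hstep h0 (by omega)
    rw [(h.absolutelyContinuous i (by omega)).eq_of_ae_hasDerivAt_zero (h.deriv_mid i hi (by omega))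
      ?_ ht ht₀]
    · exact h0 i hi (by omega)
    · filter_upwards [ae_restrict_mem measurableSet_Icc] with τ hτ
      rw [h1 τ hτ, mul_zero]

/-- If `a i` vanishes almost everywhere on {w₀ ≠ 0}, so does its derivative w₀ a_{i+1}, and dividing
by w₀ passes the vanishing to the next component. -/
theorem eq_zero_on_support (h : IsCovectorSystem s w₀ w₁ a)
    (h1 : ∀ t ∈ Icc (0 : ℝ) 1, a 1 t = 0) (i : ℕ) (hi : 1 ≤ i) (his : i + 1 ≤ s) :
    ∀ᵐ t ∂volume.restrict (Icc (0 : ℝ) 1), w₀ t ≠ 0 → a i t = 0 := by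
  induction i, hi using Nat.le_induction with
  | base =>
    filter_upwards [ae_restrict_mem measurableSet_Icc] with t ht _
    exact h1 t ht
  | succ i hi ih =>
    filter_upwards [ih (by omega), ae_eq_zero_of_hasDerivAt_of_eq_zero (h.deriv_mid i hi (by omega))]
      with t ht hd hw
    exact (mul_eq_zero.1 (hd (ht hw))).resolve_left hw

theorem exists_level (hs : 5 ≤ s) (h : IsCovectorSystem s w₀ w₁ a)
    (hw₁ : IntervalIntegrable w₁ volume 0 1)
    (h0 : ∀ t ∈ Icc (0 : ℝ) 1, a 0 t = 0) (h1 : ∀ t ∈ Icc (0 : ℝ) 1, a 1 t = 0)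
    (hne : ∃ i ≤ s, a i 0 ≠ 0) :
    ∃ α : ℝ, ∀ᵐ t ∂volume.restrict (Icc (0 : ℝ) 1),
      (w₀ t = 0 ∨ w₁ t = 0) ∧ (w₀ t ≠ 0 → ∫ τ in (0 : ℝ)..t, w₁ τ = α) := by
  have hmem0 : (0 : ℝ) ∈ Icc (0 : ℝ) 1 := ⟨le_rfl, zero_le_one⟩
  by_cases hc : a s 0 = 0
  · suffices hw : ∀ᵐ t ∂volume.restrict (Icc (0 : ℝ) 1), w₀ t = 0 by
      -- When w₀ = 0 almost everywhere the level condition is vacuous, so any value would do.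
      refine ⟨0, ?_⟩
      filter_upwards [hw] with t ht
      exact ⟨Or.inl ht, fun h => absurd ht h⟩
    by_contra hw
    have hall : ∀ᵐ t ∂volume.restrict (Icc (0 : ℝ) 1), ∀ i, 1 ≤ i → i + 1 ≤ s → w₀ t ≠ 0 → a i t = 0 := by
      rw [ae_all_iff]
      intro i
      by_cases hi : 1 ≤ i ∧ i + 1 ≤ s
      · filter_upwards [h.eq_zero_on_support h1 i hi.1 hi.2] with t ht _ _
        exact ht
      · exact Eventually.of_forall fun t h2 h3 => absurd ⟨h2, h3⟩ hi
    -- If w₀ is not almost everywhere zero, some point has w₀ ≠ 0 and all components 1, …, s - 1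
    -- zero simultaneously. The system with a_s = 0 then spreads these zeros over the whole
    -- interval.
    obtain ⟨t₀, hw₀, hz, ht₀⟩ := ((Filter.not_eventually.1 hw).and_eventually
      (hall.and (ae_restrict_mem measurableSet_Icc))).exists
    have hpen : ∀ t ∈ Icc (0 : ℝ) 1, a (s - 1) t = 0 := by
      have h2 : ∀ t ∈ Icc (0 : ℝ) 1, a (s - 1) t = a (s - 1) 0 := fun t ht => by
        rw [h.penultimate_eq hw₁ ht, hc, zero_mul, add_zero]
      intro t ht
      rw [h2 t ht, ← h2 t₀ ht₀]
      exact hz (s - 1) (by omega) (by omega) hw₀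
    obtain ⟨i, his, hi⟩ := hne
    refine hi ?_
    rcases Nat.eq_zero_or_pos i with rfl | hi0
    · exact h0 0 hmem0
    rcases eq_or_lt_of_le his with rfl | his
    · exact hc
    rcases eq_or_lt_of_le (Nat.le_sub_one_of_lt his) with rfl | his'
    · exact hpen 0 hmem0
    refine h.eq_zero_of_le (m := s - 2) (by omega) ?_ ht₀
      (fun j hj hjm => hz j hj (by omega) hw₀) hi0 (by omega) 0 hmem0
    filter_upwards [ae_restrict_mem measurableSet_Icc] with τ hτ
    rw [show s - 2 + 1 = s - 1 by omega, hpen τ hτ, mul_zero]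
  -- The level is found by solving a_{s-1}(0) + a_s ∫ w₁ = 0. Condition (i) follows because the
  -- derivative w₁ a_s of a_{s-1} also vanishes at almost all its zeros.
  · refine ⟨-a (s - 1) 0 / a s 0, ?_⟩
    filter_upwards [h.eq_zero_on_support h1 (s - 1) (by omega) (by omega),
      ae_eq_zero_of_hasDerivAt_of_eq_zero h.deriv_penultimate,
      ae_restrict_mem measurableSet_Icc] with t ht hd hmem
    refine ⟨?_, fun hw => ?_⟩
    · by_cases hw : w₀ t = 0
      · exact Or.inl hw
      · refine Or.inr ((mul_eq_zero.1 (hd (ht hw))).resolve_right ?_)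
        rwa [h.last_eq hmem]
    · have h2 := h.penultimate_eq hw₁ hmem
      rw [ht hw] at h2
      field_simp
      linarith

/-- These initial values make a_{s-1} equal to ∫ w₁ - α, which w₀ annihilates almost everywhere.
Thus a_{s-2} stays zero, and the zeros descend along the chain. -/
theorem eq_zero_of_level (hs : 5 ≤ s) (h : IsCovectorSystem s w₀ w₁ a)
    (hw₁ : IntervalIntegrable w₁ volume 0 1) {α : ℝ}
    (hα : ∀ᵐ t ∂volume.restrict (Icc (0 : ℝ) 1), w₀ t ≠ 0 → ∫ τ in (0 : ℝ)..t, w₁ τ = α)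
    (hlast : a s 0 = 1) (hpen : a (s - 1) 0 = -α) (hz : ∀ i, i + 2 ≤ s → a i 0 = 0) :
    ∀ t ∈ Icc (0 : ℝ) 1, a 0 t = 0 ∧ a 1 t = 0 := by
  have hmem0 : (0 : ℝ) ∈ Icc (0 : ℝ) 1 := ⟨le_rfl, zero_le_one⟩
  have key : ∀ i, 1 ≤ i → i ≤ s - 2 → ∀ t ∈ Icc (0 : ℝ) 1, a i t = 0 := by
    intro i hi his
    refine h.eq_zero_of_le (m := s - 2) (by omega) ?_ hmem0 (fun j _ hj => hz j (by omega)) hi his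
    filter_upwards [hα, ae_restrict_mem measurableSet_Icc] with t ht hmem
    rw [show s - 2 + 1 = s - 1 by omega, h.penultimate_eq hw₁ hmem, hlast, hpen]
    by_cases hw : w₀ t = 0
    · rw [hw, zero_mul]
    · rw [ht hw]; ring
  intro t ht
  refine ⟨?_, key 1 le_rfl (by omega) t ht⟩
  rw [(h.absolutelyContinuous 0 (Nat.zero_le _)).eq_of_ae_hasDerivAt_zero h.deriv_zero ?_ ht hmem0]
  · exact hz 0 (by omega)
  · filter_upwards [ae_restrict_mem measurableSet_Icc] with τ hτ
    -- The equation for a₀ involves a₂, which lies in the vanishing range since 2 ≤ s - 2.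
    rw [key 2 (by omega) (by omega) τ hτ, mul_zero, neg_zero]

end IsCovectorSystem

end Carnot

/-! ### The adjoint pairing, the cokernel of the differential and the conclusion -/

namespace Carnot

open Set

variable {𝔤 : Type*} [LieRing 𝔤] [LieAlgebra ℝ 𝔤]

theorem frame_neg_mul_frame (s : ℕ) (X : Module.Basis (Fin (s + 1)) ℝ 𝔤) (p : Fin (s + 1) → ℝ) :
    frame s X (-p) * frame s X p = 1 := by
  rw [frame, frame, map_neg, map_neg, neg_neg]
  exact exp_mul_exp_neg _

theorem frame_mul_frame_neg (s : ℕ) (X : Module.Basis (Fin (s + 1)) ℝ 𝔤) (p : Fin (s + 1) → ℝ) :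
    frame s X p * frame s X (-p) = 1 := by
  simpa using frame_neg_mul_frame s X (-p)

theorem contDiff_frame_neg (s : ℕ) (X : Module.Basis (Fin (s + 1)) ℝ 𝔤) :
    ContDiff ℝ 1 fun p => frame s X (-p) :=
  (contDiff_frame s X).comp contDiff_neg

/-- Differentiating the identity frame(-γ) frame(γ) = 1 gives the derivative of the inverse frame
from the one already known. -/
theorem IsHorizontalCurve.hasDerivAt_frame_neg {s : ℕ} (hs : 5 ≤ s)
    {X : Module.Basis (Fin (s + 1)) ℝ 𝔤} (hX : IsTypeIIFiliform s X)
    {u : Control} {γ : ℝ → Fin (s + 1) → ℝ} (hγ : IsHorizontalCurve s X u γ) :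
    ∀ᵐ t ∂volume.restrict (Icc (0 : ℝ) 1), HasDerivAt (fun t => frame s X (-γ t))
      (-(frame s X (-γ t) * modelControl s X (u t))) t := by
  filter_upwards [hγ.2.2, hγ.hasDerivAt_frame hs hX] with t ht hR
  have hS := ((contDiff_frame_neg s X).differentiable one_ne_zero (γ t)).hasFDerivAt.comp_hasDerivAt
    t ht
  generalize fderiv ℝ (fun p => frame s X (-p)) (γ t)
    (leftTranslationDeriv s X (γ t) (horizontalVector (s + 1) (u t))) = D at hS
  have h1 := hS.mul hR
  have h2 : ((fun p => frame s X (-p)) ∘ γ) * (fun t => frame s X (γ t)) = fun _ => 1 := by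
    funext τ
    exact frame_neg_mul_frame s X (γ τ)
  rw [h2] at h1
  have h3 := h1.unique (hasDerivAt_const t 1)
  have h4 : D = -(frame s X (-γ t) * modelControl s X (u t)) := by
    have h5 := congrArg (fun A => A * frame s X (-γ t)) h3
    simp only [Function.comp, add_mul, zero_mul, mul_assoc, frame_mul_frame_neg, mul_one] at h5
    exact eq_neg_of_add_eq_zero_left h5
  rw [← h4]
  exact hS

/-- The pairing of the covector `μ` with the image of a vector under the adjoint action. -/
noncomputable def adPair (s : ℕ) (X : Module.Basis (Fin (s + 1)) ℝ 𝔤)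
    (μ : (Fin (s + 2) → ℝ) →L[ℝ] ℝ) (p : Fin (s + 1) → ℝ) : 𝔤 →ₗ[ℝ] ℝ where
  toFun x := μ (frame s X (-p) (repL s X x (frame s X p (Pi.single 0 1))))
  map_add' x y := by simp
  map_smul' c x := by simp

theorem adPair_apply (s : ℕ) (X : Module.Basis (Fin (s + 1)) ℝ 𝔤)
    (μ : (Fin (s + 2) → ℝ) →L[ℝ] ℝ) (p : Fin (s + 1) → ℝ) (x : 𝔤) :
    adPair s X μ p x = μ (frame s X (-p) (repL s X x (frame s X p (Pi.single 0 1)))) := rfl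

theorem contDiff_adPair (s : ℕ) (X : Module.Basis (Fin (s + 1)) ℝ 𝔤)
    (μ : (Fin (s + 2) → ℝ) →L[ℝ] ℝ) (x : 𝔤) : ContDiff ℝ 1 fun p => adPair s X μ p x :=
  μ.contDiff.comp ((contDiff_frame_neg s X).clm_apply ((repL s X x).contDiff.comp
    ((contDiff_frame s X).clm_apply contDiff_const)))

theorem modelOp_single (s : ℕ) (i : Fin (s + 1)) :
    modelOp s i (Pi.single 0 1) = Pi.single i.succ (modelDiag s i) := by
  have hi := i.2
  funext k
  by_cases hk : k = i.succ
  · rw [hk, modelOp_apply_succ_self, Pi.single_eq_same, Pi.single_eq_same, mul_one]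
  · rw [Pi.single_eq_of_ne hk]
    have hk' : (k : ℕ) ≠ i + 1 := fun h => hk (Fin.ext (by simpa using h))
    have hsingle : ∀ m : Fin (s + 2), (m : ℕ) ≠ 0 → (Pi.single 0 1 : Fin (s + 2) → ℝ) m = 0 :=
      fun m hm => Pi.single_eq_of_ne (fun h => hm (by simp [h])) _
    rw [modelOp_apply, modelFun]
    split_ifs
    · omega
    · rw [hsingle _ (by simp; omega), neg_zero]
    · rfl
    · omega
    · rfl
    · rw [hsingle _ (by simp; omega), sub_zero]
    · rw [sub_zero]

theorem adPair_zero_basis (s : ℕ) (X : Module.Basis (Fin (s + 1)) ℝ 𝔤)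
    (μ : (Fin (s + 2) → ℝ) →L[ℝ] ℝ) (i : Fin (s + 1)) :
    adPair s X μ 0 (X i) = modelDiag s i * μ (Pi.single i.succ 1) := by
  rw [adPair_apply, neg_zero, frame_zero, one_apply_eq_self, one_apply_eq_self, repL_apply, rep_basis,
    modelOp_single, ← smul_eq_mul, ← map_smul]
  congr 1
  rw [← Pi.single_smul, smul_eq_mul, mul_one]

/-- The derivatives of the two outer frames combine into the commutator of rep(u) and rep(x), which
is rep of the bracket. -/
theorem IsHorizontalCurve.hasDerivAt_adPair {s : ℕ} (hs : 5 ≤ s)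
    {X : Module.Basis (Fin (s + 1)) ℝ 𝔤} (hX : IsTypeIIFiliform s X)
    {u : Control} {γ : ℝ → Fin (s + 1) → ℝ} (hγ : IsHorizontalCurve s X u γ)
    (μ : (Fin (s + 2) → ℝ) →L[ℝ] ℝ) (x : 𝔤) :
    ∀ᵐ t ∂volume.restrict (Icc (0 : ℝ) 1), HasDerivAt (fun t => adPair s X μ (γ t) x)
      (adPair s X μ (γ t) ⁅u t 0 • X 0 + u t 1 • X 1, x⁆) t := by
  filter_upwards [hγ.hasDerivAt_frame hs hX, hγ.hasDerivAt_frame_neg hs hX] with t hR hS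
  have h1 := hR.clm_apply (hasDerivAt_const t (Pi.single (0 : Fin (s + 2)) (1 : ℝ)))
  have h2 := hS.clm_apply ((repL s X x).hasFDerivAt.comp_hasDerivAt t h1)
  have h3 := μ.hasFDerivAt.comp_hasDerivAt t h2
  refine h3.congr_deriv ?_
  rw [adPair_apply, hX.repL_lie hs, modelControl_apply]
  congr 1
  simp only [neg_apply, mul_apply_eq_comp, map_zero, add_zero, Function.comp, sub_apply, map_sub,
    map_neg, neg_neg]
  abel

section Brackets

variable {s : ℕ} {X : Module.Basis (Fin (s + 1)) ℝ 𝔤}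

theorem IsTypeIIFiliform.bracket_control_first (hs : 5 ≤ s) (hX : IsTypeIIFiliform s X) (b c : ℝ) :
    ⁅b • X 0 + c • X 1, X 0⁆ = -(c • X ⟨2, by omega⟩) := by
  have h1 := fin_val_one hs
  rw [add_lie, smul_lie, smul_lie, lie_self, ← lie_skew (X 1) (X 0),
    hX.bracket_first 1 ⟨2, by omega⟩ (by omega) (by omega) (by simp only [h1])]
  simp

theorem IsTypeIIFiliform.bracket_control_mid (hs : 5 ≤ s) (hX : IsTypeIIFiliform s X) (b c : ℝ) (i : ℕ)
    (h1 : 1 ≤ i) (h2 : i + 2 ≤ s) :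
    ⁅b • X 0 + c • X 1, X ⟨i, by omega⟩⁆ = b • X ⟨i + 1, by omega⟩ := by
  have h := fin_val_one hs
  rw [add_lie, smul_lie, smul_lie, hX.bracket_first ⟨i, by omega⟩ ⟨i + 1, by omega⟩ h1 h2 rfl,
    hX.bracket_zero 1 ⟨i, by omega⟩ (by omega) h1 (by simp only [h]; omega), smul_zero, add_zero]

theorem IsTypeIIFiliform.bracket_control_penultimate (hs : 5 ≤ s) (hX : IsTypeIIFiliform s X)
    (b c : ℝ) : ⁅b • X 0 + c • X 1, X ⟨s - 1, by omega⟩⁆ = c • X ⟨s, by omega⟩ := by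
  have h := fin_val_one hs
  rw [add_lie, smul_lie, smul_lie, hX.bracket_first_zero ⟨s - 1, by omega⟩ (by simp only []; omega),
    hX.bracket_eq_smul_last 1 ⟨s - 1, by omega⟩ (by omega) (by simp only []; omega)
      (by simp only [h]; omega), h]
  simp [Fin.last]

theorem IsTypeIIFiliform.bracket_control_last (hs : 5 ≤ s) (hX : IsTypeIIFiliform s X)
    (b c : ℝ) : ⁅b • X 0 + c • X 1, X ⟨s, by omega⟩⁆ = 0 := by
  have h := fin_val_one hs
  rw [add_lie, smul_lie, smul_lie, hX.bracket_first_zero ⟨s, by omega⟩ (by simp only []; omega),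
    hX.bracket_zero 1 ⟨s, by omega⟩ (by omega) (by simp only []; omega) (by simp only [h]; omega)]
  simp

end Brackets

/-- The components `⟨μ, Ad (exp (-p)) X_{n + 1}⟩` of a covector, extended by zero. -/
noncomputable def covectorComp (s : ℕ) (X : Module.Basis (Fin (s + 1)) ℝ 𝔤) (μ : (Fin (s + 2) → ℝ) →L[ℝ] ℝ)
    (γ : ℝ → Fin (s + 1) → ℝ) (n : ℕ) (t : ℝ) : ℝ :=
  if h : n < s + 1 then adPair s X μ (γ t) (X ⟨n, h⟩) else 0

theorem covectorComp_of_lt {s : ℕ} (X : Module.Basis (Fin (s + 1)) ℝ 𝔤)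
    (μ : (Fin (s + 2) → ℝ) →L[ℝ] ℝ) (γ : ℝ → Fin (s + 1) → ℝ) {n : ℕ} (h : n < s + 1) :
    covectorComp s X μ γ n = fun t => adPair s X μ (γ t) (X ⟨n, h⟩) :=
  funext fun _ => dif_pos h

theorem IsHorizontalCurve.absolutelyContinuous_adPair {s : ℕ}
    {X : Module.Basis (Fin (s + 1)) ℝ 𝔤} {u : Control} {γ : ℝ → Fin (s + 1) → ℝ}
    (hγ : IsHorizontalCurve s X u γ) (μ : (Fin (s + 2) → ℝ) →L[ℝ] ℝ) (x : 𝔤) :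
    AbsolutelyContinuousOnInterval (fun t => adPair s X μ (γ t) x) 0 1 :=
  hγ.1.contDiff_comp (g := fun p => adPair s X μ p x) (contDiff_adPair s X μ x)

theorem IsHorizontalCurve.isCovectorSystem {s : ℕ} (hs : 5 ≤ s)
    {X : Module.Basis (Fin (s + 1)) ℝ 𝔤} (hX : IsTypeIIFiliform s X)
    {u : Control} {γ : ℝ → Fin (s + 1) → ℝ} (hγ : IsHorizontalCurve s X u γ)
    (μ : (Fin (s + 2) → ℝ) →L[ℝ] ℝ) :
    IsCovectorSystem s (fun t => u t 0) (fun t => u t 1) (covectorComp s X μ γ) where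
  absolutelyContinuous i hi := by
    rw [covectorComp_of_lt X μ γ (Nat.lt_succ_of_le hi)]
    exact hγ.absolutelyContinuous_adPair μ _
  deriv_zero := by
    rw [covectorComp_of_lt X μ γ (by omega), covectorComp_of_lt X μ γ (n := 2) (by omega)]
    filter_upwards [hγ.hasDerivAt_adPair hs hX μ (X 0)] with t ht
    rwa [hX.bracket_control_first hs, map_neg, map_smul, smul_eq_mul] at ht
  deriv_mid i h1 h2 := by
    rw [covectorComp_of_lt X μ γ (by omega), covectorComp_of_lt X μ γ (n := i + 1) (by omega)]
    filter_upwards [hγ.hasDerivAt_adPair hs hX μ (X ⟨i, by omega⟩)] with t ht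
    rwa [hX.bracket_control_mid hs _ _ i h1 h2, map_smul, smul_eq_mul] at ht
  deriv_penultimate := by
    rw [covectorComp_of_lt X μ γ (by omega), covectorComp_of_lt X μ γ (n := s) (by omega)]
    filter_upwards [hγ.hasDerivAt_adPair hs hX μ (X ⟨s - 1, by omega⟩)] with t ht
    rwa [hX.bracket_control_penultimate hs, map_smul, smul_eq_mul] at ht
  deriv_last := by
    rw [covectorComp_of_lt X μ γ (by omega)]
    filter_upwards [hγ.hasDerivAt_adPair hs hX μ (X ⟨s, by omega⟩)] with t ht
    rwa [hX.bracket_control_last hs, map_zero] at ht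

theorem intervalIntegrable_control_coord (u : Control) (i : Fin 2) :
    IntervalIntegrable (fun t => u t i) volume 0 1 := by
  rw [intervalIntegrable_iff_integrableOn_Icc_of_le zero_le_one]
  exact (EuclideanSpace.proj (𝕜 := ℝ) i).integrable_comp (L1.integrable_coeFn u)

theorem IsHorizontalCurve.continuousOn_adPair {s : ℕ}
    {X : Module.Basis (Fin (s + 1)) ℝ 𝔤}
    {u : Control} {γ : ℝ → Fin (s + 1) → ℝ} (hγ : IsHorizontalCurve s X u γ)
    (μ : (Fin (s + 2) → ℝ) →L[ℝ] ℝ) (x : 𝔤) :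
    ContinuousOn (fun t => adPair s X μ (γ t) x) (Icc 0 1) := by
  have h1 := hγ.1.continuousOn
  rw [uIcc_of_le zero_le_one] at h1
  exact (contDiff_adPair s X μ x).continuous.comp_continuousOn h1

/-- The differential of the model endpoint map, in terms of the adjoint action. -/
theorem IsHorizontalCurve.apply_fderiv_linSol {s : ℕ} (hs : 5 ≤ s)
    {X : Module.Basis (Fin (s + 1)) ℝ 𝔤} (hX : IsTypeIIFiliform s X)
    {u : Control} {γ : ℝ → Fin (s + 1) → ℝ} (hγ : IsHorizontalCurve s X u γ)
    (μ : (Fin (s + 2) → ℝ) →L[ℝ] ℝ) (v : Control) :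
    μ (frame s X (-γ 1) (fderiv ℝ (linSol (modelControl s X) (Pi.single 0 1)) u v 1))
      = ∫ t in (0 : ℝ)..1,
        -(v t 0 * adPair s X μ (γ t) (X 0) + v t 1 * adPair s X μ (γ t) (X 1)) := by
  have hB := modelControl_strictly_triangular s X
  have hfd := fderiv_linSol_eq hB (Pi.single 0 1) u v
  set f := linSol (modelControl s X) (Pi.single 0 1) u with hf
  set δ := fderiv ℝ (linSol (modelControl s X) (Pi.single 0 1)) u v with hδ
  have hi1 := intervalIntegrable_control_apply (modelControl s X) v
    f.continuous_IccExtend_zero_one.continuousOn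
  have hi2 := intervalIntegrable_control_apply (modelControl s X) u
    δ.continuous_IccExtend_zero_one.continuousOn
  have hy : ∀ t ∈ Icc (0 : ℝ) 1, ∫ τ in (0 : ℝ)..t,
      (modelControl s X (v τ) (IccExtend zero_le_one f τ)
        + modelControl s X (u τ) (IccExtend zero_le_one δ τ)) = IccExtend zero_le_one δ t := by
    intro t ht
    rw [intervalIntegral.integral_add (hi1.mono_zero_one ht) (hi2.mono_zero_one ht),
      IccExtend_of_mem _ _ ht]
    exact (congrArg (fun h => h ⟨t, ht⟩) hfd).symm
  have hi := hi1.add hi2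
  have hyAC := hi.absolutelyContinuousOnInterval_integral
  have hyd := hi.ae_hasDerivAt_integral
  -- The variation δ lives only on [0,1]; `y` is a curve on the line that agrees with it there and
  -- can be differentiated. Applying frame(-γ) then removes the homogeneous term B(u) y.
  set y : ℝ → Fin (s + 2) → ℝ := fun t => ∫ τ in (0 : ℝ)..t,
      (modelControl s X (v τ) (IccExtend zero_le_one f τ)
        + modelControl s X (u τ) (IccExtend zero_le_one δ τ)) with hydef
  have hzAC : AbsolutelyContinuousOnInterval (fun t => μ (frame s X (-γ t) (y t))) 0 1 :=
    (hγ.1.prodMk hyAC).contDiff_comp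
      (g := fun z : (Fin (s + 1) → ℝ) × (Fin (s + 2) → ℝ) => μ (frame s X (-z.1) z.2))
      (μ.contDiff.comp (((contDiff_frame_neg s X).comp contDiff_fst).clm_apply contDiff_snd))
  have hzd : ∀ᵐ t ∂volume.restrict (Icc (0 : ℝ) 1), HasDerivAt (fun t => μ (frame s X (-γ t) (y t)))
      (-(v t 0 * adPair s X μ (γ t) (X 0) + v t 1 * adPair s X μ (γ t) (X 1))) t := by
    filter_upwards [hγ.hasDerivAt_frame_neg hs hX, ae_restrict_of_ae hyd,
      ae_restrict_mem measurableSet_Icc] with t hS hyt hmem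
    have h1 := hyt (by rwa [uIcc_of_le zero_le_one]) 0 left_mem_uIcc
    have h2 := μ.hasFDerivAt.comp_hasDerivAt t (hS.clm_apply h1)
    refine h2.congr_deriv ?_
    have h3 : y t = IccExtend zero_le_one δ t := hy t hmem
    have h4 : IccExtend zero_le_one f t = frame s X (γ t) (Pi.single 0 1) := by
      rw [IccExtend_of_mem _ _ hmem, hf]
      exact (hγ.frame_apply_eq_linSol hs hX ⟨t, hmem⟩).symm
    have h5 : v t 0 * adPair s X μ (γ t) (X 0) + v t 1 * adPair s X μ (γ t) (X 1)
        = adPair s X μ (γ t) (v t 0 • X 0 + v t 1 • X 1) := by simp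
    rw [h5, adPair_apply, h4, modelControl_apply s X (v t)]
    change μ (-(frame s X (-γ t) * modelControl s X (u t)) (y t) + _) = _
    rw [h3, neg_apply, mul_apply_eq_comp]
    simp only [map_add, map_neg]
    abel
  have hint : IntervalIntegrable (fun t =>
      -(v t 0 * adPair s X μ (γ t) (X 0) + v t 1 * adPair s X μ (γ t) (X 1))) volume 0 1 := by
    have hc : ∀ x, ContinuousOn (fun t => adPair s X μ (γ t) x) (uIcc 0 1) := fun x => by
      rw [uIcc_of_le zero_le_one]
      exact hγ.continuousOn_adPair μ x
    exact (((intervalIntegrable_control_coord v 0).mul_continuousOn (hc _)).add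
      ((intervalIntegrable_control_coord v 1).mul_continuousOn (hc _))).neg
  have hmem1 : (1 : ℝ) ∈ Icc (0 : ℝ) 1 := ⟨zero_le_one, le_rfl⟩
  rw [← hzAC.sub_eq_integral hint hzd hmem1]
  have h0 : y 0 = 0 := by simp [hydef]
  have h1 : y 1 = δ 1 := (hy 1 hmem1).trans (IccExtend_of_mem _ _ hmem1)
  simp only [h0, h1, map_zero, sub_zero]

theorem exists_control_ae_eq {f₀ f₁ : ℝ → ℝ} (h0 : ContinuousOn f₀ (Icc 0 1))
    (h1 : ContinuousOn f₁ (Icc 0 1)) :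
    ∃ v : Control, ∀ᵐ t ∂volume.restrict (Icc (0 : ℝ) 1), v t 0 = f₀ t ∧ v t 1 = f₁ t := by
  have hc : ContinuousOn (fun t => !₂[f₀ t, f₁ t]) (Icc 0 1) := by
    refine (PiLp.continuous_toLp 2 _).comp_continuousOn (continuousOn_pi.2 fun i => ?_)
    fin_cases i
    · exact h0
    · exact h1
  have hi : Integrable (fun t => !₂[f₀ t, f₁ t]) (volume.restrict (Icc (0 : ℝ) 1)) :=
    hc.integrableOn_compact isCompact_Icc
  refine ⟨hi.toL1 _, ?_⟩
  filter_upwards [hi.coeFn_toL1] with t ht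
  rw [ht]
  simp

/-- The two pairings, being continuous on [0,1], themselves form an admissible test control; the
integral becomes that of a continuous sum of squares. -/
theorem IsHorizontalCurve.adPair_eq_zero_of_integral {s : ℕ}
    {X : Module.Basis (Fin (s + 1)) ℝ 𝔤}
    {u : Control} {γ : ℝ → Fin (s + 1) → ℝ} (hγ : IsHorizontalCurve s X u γ)
    (μ : (Fin (s + 2) → ℝ) →L[ℝ] ℝ)
    (h : ∀ v : Control, ∫ t in (0 : ℝ)..1,
        -(v t 0 * adPair s X μ (γ t) (X 0) + v t 1 * adPair s X μ (γ t) (X 1)) = 0) :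
    ∀ t ∈ Icc (0 : ℝ) 1, adPair s X μ (γ t) (X 0) = 0 ∧ adPair s X μ (γ t) (X 1) = 0 := by
  have h0 := hγ.continuousOn_adPair μ (X 0)
  have h1 := hγ.continuousOn_adPair μ (X 1)
  obtain ⟨v, hv⟩ := exists_control_ae_eq h0 h1
  have h2 : ∫ t in (0 : ℝ)..1,
      (adPair s X μ (γ t) (X 0) ^ 2 + adPair s X μ (γ t) (X 1) ^ 2) = 0 := by
    have h3 : ∫ t in (0 : ℝ)..1,
        (v t 0 * adPair s X μ (γ t) (X 0) + v t 1 * adPair s X μ (γ t) (X 1)) = 0 :=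
      neg_eq_zero.1 (intervalIntegral.integral_neg.symm.trans (h v))
    refine Eq.trans (intervalIntegral.integral_congr_ae_restrict ?_) h3
    filter_upwards [ae_restrict_uIoc_of_ae hv (t := (1 : ℝ)) ⟨zero_le_one, le_rfl⟩] with t ht
    rw [ht.1, ht.2, sq, sq]
  intro t ht
  by_contra hne
  have hpos : 0 < adPair s X μ (γ t) (X 0) ^ 2 + adPair s X μ (γ t) (X 1) ^ 2 := by
    rcases not_and_or.1 hne with h | h
    · exact add_pos_of_pos_of_nonneg (sq_pos_iff.2 h) (sq_nonneg _)
    · exact add_pos_of_nonneg_of_pos (sq_nonneg _) (sq_pos_iff.2 h)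
  have := intervalIntegral.integral_pos zero_lt_one ((h0.pow 2).add (h1.pow 2))
    (fun _ _ => add_nonneg (sq_nonneg _) (sq_nonneg _)) ⟨t, ht, hpos⟩
  exact this.ne' h2

theorem fderiv_modelEndpoint_apply (s : ℕ) (X : Module.Basis (Fin (s + 1)) ℝ 𝔤) (u v : Control) :
    fderiv ℝ (modelEndpoint s X) u v
      = tailL s (fderiv ℝ (linSol (modelControl s X) (Pi.single 0 1)) u v 1) := by
  rw [(hasFDerivAt_modelEndpoint s X u).fderiv]
  rfl

theorem fderiv_linSol_apply_zero (s : ℕ) (X : Module.Basis (Fin (s + 1)) ℝ 𝔤) (u v : Control)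
    (t : Icc (0 : ℝ) 1) :
    fderiv ℝ (linSol (modelControl s X) (Pi.single 0 1)) u v t 0 = 0 := by
  have hB := modelControl_strictly_triangular s X
  have h1 : ∀ u f, volterra (modelControl s X) u f t 0 = 0 := fun u f => by
    simpa using volterra_pow_apply_eq_zero hB u f 1 t 0 (by simp)
  rw [fderiv_linSol_eq hB, ContinuousMap.add_apply, Pi.add_apply, h1, h1, add_zero]

/-- A proper range is annihilated by a nonzero functional at the final time, and composing it with
`frame s X (γ 1)` transports it to time 0. Nontriviality is expressed through the pairings with the
basis because the value of μ on e₀ never matters. -/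
theorem IsHorizontalCurve.not_surjective_iff {s : ℕ} (hs : 5 ≤ s)
    {X : Module.Basis (Fin (s + 1)) ℝ 𝔤} (hX : IsTypeIIFiliform s X)
    {u : Control} {γ : ℝ → Fin (s + 1) → ℝ} (hγ : IsHorizontalCurve s X u γ) :
    ¬ Function.Surjective (fderiv ℝ (modelEndpoint s X) u) ↔
      ∃ μ : (Fin (s + 2) → ℝ) →L[ℝ] ℝ, (∃ i, adPair s X μ (γ 0) (X i) ≠ 0) ∧
        ∀ t ∈ Icc (0 : ℝ) 1, adPair s X μ (γ t) (X 0) = 0 ∧ adPair s X μ (γ t) (X 1) = 0 := by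
  have hcons : ∀ f : Fin (s + 2) → ℝ, f 0 = 0 → f = ∑ i : Fin (s + 1), f i.succ • Pi.single i.succ 1 := by
    intro f hf
    have h1 := pi_eq_sum_univ' f
    rw [Fin.sum_univ_succ, hf, zero_smul, zero_add] at h1
    rw [h1]
    simp [Pi.single_apply]
  constructor
  · intro hns
    have hlt : LinearMap.range (fderiv ℝ (modelEndpoint s X) u).toLinearMap < ⊤ :=
      lt_top_iff_ne_top.2 fun h => hns (LinearMap.range_eq_top.1 h)
    obtain ⟨ℓ, hℓ, hker⟩ := Submodule.exists_le_ker_of_lt_top _ hlt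
    have hℓ0 : ∀ v, ℓ (fderiv ℝ (modelEndpoint s X) u v) = 0 := fun v =>
      hker (LinearMap.mem_range_self (fderiv ℝ (modelEndpoint s X) u).toLinearMap v)
    set ℓ' : (Fin (s + 1) → ℝ) →L[ℝ] ℝ := LinearMap.toContinuousLinearMap ℓ with hℓ'
    refine ⟨(ℓ'.comp (tailL s)).comp (frame s X (γ 1)), ?_, ?_⟩
    · by_contra! hz
      refine hℓ (LinearMap.ext fun y => ?_)
      have hμ : ∀ i : Fin (s + 1),
          (ℓ'.comp (tailL s)).comp (frame s X (γ 1)) (Pi.single i.succ 1) = 0 := fun i => by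
        have h1 := hz i
        rw [hγ.2.1, adPair_zero_basis] at h1
        exact (mul_eq_zero.1 h1).resolve_left (modelDiag_ne_zero s i)
      set f := frame s X (-γ 1) (Fin.cons 0 y) with hf
      have hf0 : f 0 = 0 := by rw [hf, frame_apply_zero]; rfl
      have h2 : (ℓ'.comp (tailL s)).comp (frame s X (γ 1)) f = 0 := by
        rw [hcons f hf0, map_sum]
        refine Finset.sum_eq_zero fun i _ => ?_
        rw [map_smul, hμ i, smul_zero]
      have h3 : frame s X (γ 1) f = Fin.cons 0 y := by
        rw [hf, ← mul_apply_eq_comp, frame_mul_frame_neg, one_apply_eq_self]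
      rw [ContinuousLinearMap.comp_apply, h3] at h2
      exact h2
    · refine hγ.adPair_eq_zero_of_integral _ fun v => ?_
      rw [← hγ.apply_fderiv_linSol hs hX, ContinuousLinearMap.comp_apply,
        ← mul_apply_eq_comp (frame s X (γ 1)), frame_mul_frame_neg, one_apply_eq_self,
        ContinuousLinearMap.comp_apply, ← fderiv_modelEndpoint_apply]
      exact hℓ0 v
  · rintro ⟨μ, ⟨i, hi⟩, hz⟩ hsurj
    refine hi ?_
    have hμ : μ (Pi.single i.succ 1) = 0 := by
      -- This target is chosen so that transport back by frame(-γ 1) returns exactly the basis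
      -- state; the constant entry, which `tailL` forgets, is zero on both sides.
      obtain ⟨v, hv⟩ := hsurj (tailL s (frame s X (γ 1) (Pi.single i.succ 1)))
      rw [fderiv_modelEndpoint_apply] at hv
      have h1 : fderiv ℝ (linSol (modelControl s X) (Pi.single 0 1)) u v 1
          = frame s X (γ 1) (Pi.single i.succ 1) := by
        funext k
        induction k using Fin.cases with
        | zero =>
          rw [fderiv_linSol_apply_zero, frame_apply_zero, Pi.single_eq_of_ne (Fin.succ_ne_zero i).symm]
        | succ k => exact congrFun hv k
      have h2 := hγ.apply_fderiv_linSol hs hX μ v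
      rw [h1, ← mul_apply_eq_comp, frame_neg_mul_frame, one_apply_eq_self] at h2
      rw [h2]
      refine intervalIntegral.integral_zero_ae (Filter.Eventually.of_forall fun t ht => ?_)
      rw [uIoc_of_le zero_le_one] at ht
      have h3 := hz t ⟨ht.1.le, ht.2⟩
      rw [h3.1, h3.2]
      simp
    rw [hγ.2.1, adPair_zero_basis, hμ, mul_zero]

theorem exists_covector (s : ℕ) (X : Module.Basis (Fin (s + 1)) ℝ 𝔤) (c : Fin (s + 1) → ℝ) :
    ∃ μ : (Fin (s + 2) → ℝ) →L[ℝ] ℝ, ∀ i, adPair s X μ 0 (X i) = c i := by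
  refine ⟨∑ i, (c i / modelDiag s i) • ContinuousLinearMap.proj i.succ, fun i => ?_⟩
  rw [adPair_zero_basis]
  have hd := modelDiag_ne_zero s i
  simp [Pi.single_apply, hd, mul_div_cancel₀]

theorem isSingularControl_iff {s : ℕ} (hs : 5 ≤ s)
    {X : Module.Basis (Fin (s + 1)) ℝ 𝔤} (hX : IsTypeIIFiliform s X) (u : Control) :
    IsSingularControl s X u ↔
      ∃ a : ℝ, ∀ᵐ t ∂(volume.restrict (Icc (0 : ℝ) 1)),
        (u t 0 = 0 ∨ u t 1 = 0) ∧ (u t 0 ≠ 0 → ∫ τ in (0 : ℝ)..t, u τ 1 = a) := by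
  obtain ⟨γ, hγ⟩ := exists_isHorizontalCurve hs hX u
  have hw := intervalIntegrable_control_coord u 1
  have hone : (1 : Fin (s + 1)) = ⟨1, by omega⟩ := Fin.ext (fin_val_one hs)
  rw [IsSingularControl, surjective_fderiv_endpointMap_iff hs hX, hγ.not_surjective_iff hs hX]
  constructor
  · rintro ⟨μ, ⟨i, hi⟩, hz⟩
    refine (hγ.isCovectorSystem hs hX μ).exists_level hs hw (fun t ht => ?_) (fun t ht => ?_) ⟨i, ?_, ?_⟩
    · rw [covectorComp_of_lt X μ γ (by omega)]
      exact (hz t ht).1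
    · rw [covectorComp_of_lt X μ γ (by omega), ← hone]
      exact (hz t ht).2
    · exact Nat.le_of_lt_succ i.2
    · rw [covectorComp_of_lt X μ γ i.2]
      exact hi
  · rintro ⟨α, hα⟩
    -- The initial data prescribed by the level: a_s = 1 and a_{s-1}(0) = -α, with everything else
    -- zero.
    obtain ⟨μ, hμ⟩ := exists_covector s X
      fun i => if (i : ℕ) = s then 1 else if (i : ℕ) = s - 1 then -α else 0
    have hval : ∀ i (h : i < s + 1), covectorComp s X μ γ i 0
        = if i = s then 1 else if i = s - 1 then -α else 0 := fun i h => by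
      rw [covectorComp, dif_pos h, hγ.2.1, hμ]
    refine ⟨μ, ⟨⟨s, by omega⟩, ?_⟩, fun t ht => ?_⟩
    · rw [hγ.2.1, hμ, if_pos rfl]
      exact one_ne_zero
    · have h1 := (hγ.isCovectorSystem hs hX μ).eq_zero_of_level hs hw (α := α)
        (hα.mono fun t ht => ht.2)
        (by rw [hval s (by omega), if_pos rfl])
        (by rw [hval _ (by omega), if_neg (by omega), if_pos rfl])
        (fun i hi => by rw [hval i (by omega), if_neg (by omega), if_neg (by omega)]) t ht
      rw [covectorComp_of_lt X μ γ (by omega), covectorComp_of_lt X μ γ (n := 1) (by omega),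
        ← hone] at h1
      exact h1

end Carnot

theorem mainTheorem5 {𝔤 : Type*} [LieRing 𝔤] [LieAlgebra ℝ 𝔤] (s : ℕ) (hs : 5 ≤ s)
    (X : Module.Basis (Fin (s + 1)) ℝ 𝔤) (hX : Carnot.IsTypeIIFiliform s X) :
    (∀ u : Carnot.Control,
      (∃ γ, Carnot.IsHorizontalCurve s X u γ) ∧
      ∀ γ γ', Carnot.IsHorizontalCurve s X u γ → Carnot.IsHorizontalCurve s X u γ' →
        Set.EqOn γ γ' (Set.Icc 0 1)) ∧
    Differentiable ℝ (Carnot.endpointMap s X) ∧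
    ∀ u : Carnot.Control,
      Carnot.IsSingularControl s X u ↔
        ∃ a : ℝ, ∀ᵐ t ∂(MeasureTheory.volume.restrict (Set.Icc (0 : ℝ) 1)),
          (u t 0 = 0 ∨ u t 1 = 0) ∧ (u t 0 ≠ 0 → ∫ τ in (0 : ℝ)..t, u τ 1 = a) := by
  exact ⟨fun u => ⟨Carnot.exists_isHorizontalCurve hs hX u, fun γ γ' h h' => h.eqOn hs hX h'⟩,
    Carnot.differentiable_endpointMap hs hX, Carnot.isSingularControl_iff hs hX⟩
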